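/- Let $\mathbf k$ be a field with $\operatorname{char}(\mathbf k)\neq 2$ and let $n\ge 1$. Let $E(n)$ be the Hopf algebra over $\mathbf k$ generated by $c,x_1,\dots,x_n$ with relations $c^2=1$, $cx_i+x_ic=0$, $x_ix_j+x_jx_i=0$, $x_i^2=0$, coproduct $\Delta(c)=c\otimes c$, $\Delta(x_i)=1\otimes x_i+x_i\otimes c$, counit $\varepsilon(c)=1$, $\varepsilon(x_i)=0$ and antipode $S(c)=c$, $S(x_i)=cx_i$. For $P\subseteq\{1,\dots,n\}$ let $x_P$ be the product of the $x_j$ with $j\in P$ in increasing order; the elements $x_P$, $cx_P$ form a basis of $E(n)$, and $(x_P)^*$, $(cx_P)^*$ denotes the dual basis. For $A=(a_{ij})\in M_n(\mathbf k)$ let $r_A$ be the universal $r$-form $$r_A=\sum_{P}(-1)^{\frac{|P|(|P|-1)}2}\sum_{F,\,|F|=|P|}\ \sum_{\eta\in S_{|P|}}\operatorname{sign}(\eta)\,a_{p_1,f_{\eta(1)}}\cdots a_{p_s,f_{\eta(s)}}\bigl((x_P)^*\otimes(x_F)^*+(cx_P)^*\otimes(x_F)^*+(-1)^{|P|}(x_P)^*\otimes(cx_F)^*-(-1)^{|P|}(cx_P)^*\otimes(cx_F)^*\bigr),$$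 where $P=\{p_1<\dots<p_s\}$ and $F=\{f_1<\dots<f_s\}$. Let $\alpha\in\mathbf k$ be nonzero, $\gamma\in\mathbf k^n$, and let $\Lambda=(\lambda_{ij})\in M_n(\mathbf k)$ be lower triangular. Let $Cl(\alpha,\gamma,\Lambda)$ be the algebra generated by $u,v_1,\dots,v_n$ with relations $u^2=\alpha$, $uv_i+v_iu=\gamma_i$, $v_i^2=\lambda_{ii}$, and $v_iv_j+v_jv_i=\lambda_{ij}$ for $i>j$, with the right $E(n)$-comodule algebra structure $\rho(u)=u\otimes c$, $\rho(v_i)=1\otimes x_i+v_i\otimes c$. For a Hopf algebra $H$ with universal $r$-form $r$, a finite-dimensional right $H$-comodule $B$ which is an algebra with $\rho(1)=1\otimes 1$ and $\rho(ab)=\sum a_{(0)}b_{(0)}\otimes b_{(1)}a_{(1)}$ is called $(H,r)$-Azumaya if the linear maps $F,G\colon B\otimes B\to\operatorname{End}_{\mathbf k}(B)$, $$F(a\otimes b)(d)=\sum a\,d_{(0)}b_{(0)}\,r(d_{(1)}\otimes b_{(1)}),\qquad G(a\otimes b)(d)=\sum r(a_{(1)}\otimes d_{(1)})\,a_{(0)}d_{(0)}\,b,$$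 are both bijective. Then the opposite algebra $Cl(\alpha,\gamma,\Lambda)^{op}$, with the same coaction $\rho$, is $(E(n),r_A)$-Azumaya if and only if $$\det\bigl(2\alpha(A-\Lambda-\Lambda^t)+\Gamma\bigr)\neq 0,\qquad \Gamma_{ij}=\gamma_i\gamma_j .$$ -/

import Mathlib

open scoped TensorProduct

noncomputable section

namespace HopfE

universe u

section Braided

variable (k : Type*) [Field k] (H : Type*) [Ring H] [HopfAlgebra k H]

/-- A right `H`-comodule algebra: an algebra `B` with a coassociative and counital coaction
`ρ : B → B ⊗ H` that is an algebra map. -/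
structure RightComoduleAlgebra (B : Type*) [Ring B] [Algebra k B] where
  coact : B →ₐ[k] B ⊗[k] H
  coassoc : TensorProduct.assoc k B H H ∘ₗ coact.toLinearMap.rTensor H ∘ₗ coact.toLinearMap =
    (Coalgebra.comul (R := k) (A := H)).lTensor B ∘ₗ coact.toLinearMap
  counit : TensorProduct.rid k B ∘ₗ (Coalgebra.counit (R := k) (A := H)).lTensor B ∘ₗ
    coact.toLinearMap = LinearMap.id

/-- An algebra in the category of finite-dimensional right `H`-comodules, where `M ⊗ N` has the
coaction `m ⊗ n ↦ ∑ m₀ ⊗ n₀ ⊗ n₁ m₁`. Equivalently, a finite-dimensional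
right `H^op`-comodule algebra: the coaction satisfies `ρ(ab) = ∑ a₀ b₀ ⊗ b₁ a₁`. -/
structure ComodAlg (A : Type*) [Ring A] [Algebra k A] where
  finite : Module.Finite k A
  coact : A →ₗ[k] A ⊗[k] H
  coassoc : TensorProduct.assoc k A H H ∘ₗ coact.rTensor H ∘ₗ coact =
    (Coalgebra.comul (R := k) (A := H)).lTensor A ∘ₗ coact
  counit : TensorProduct.rid k A ∘ₗ (Coalgebra.counit (R := k) (A := H)).lTensor A ∘ₗ coact =
    LinearMap.id
  map_one : coact 1 = 1 ⊗ₜ 1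
  map_mul : ∀ a b, coact (a * b) =
    TensorProduct.map₂ (LinearMap.mul k A) (LinearMap.mul k H).flip (coact a) (coact b)

variable {k H}

/-- If `B` is a finite-dimensional right `H`-comodule algebra, the opposite algebra `B^op` with
the same coaction is an algebra in the category of right `H`-comodules. -/
def RightComoduleAlgebra.op {B : Type*} [Ring B] [Algebra k B] [Module.Finite k B]
    (S : RightComoduleAlgebra k H B) : ComodAlg k H Bᵐᵒᵖ where
  finite := inferInstance
  coact := (MulOpposite.opLinearEquiv k (M := B)).toLinearMap.rTensor H ∘ₗ
    S.coact.toLinearMap ∘ₗ (MulOpposite.opLinearEquiv k (M := B)).symm.toLinearMap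
  coassoc := by
    ext b
    induction b with | h b =>
    have h := LinearMap.congr_fun S.coassoc b
    simp only [LinearMap.comp_apply, LinearEquiv.coe_coe, AlgHom.toLinearMap_apply] at h ⊢
    have h' := congrArg
      ((MulOpposite.opLinearEquiv k (M := B)).toLinearMap.rTensor (H ⊗[k] H)) h
    simp only [MulOpposite.coe_opLinearEquiv_symm, MulOpposite.unop_op]
    generalize S.coact b = t at h' ⊢
    refine Eq.trans ?_ (h'.trans ?_)
    · clear h h'
      induction t with
      | zero => simp
      | add x y hx hy => simp only [map_add, hx, hy]
      | tmul x y =>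
        simp only [LinearMap.rTensor_tmul, LinearMap.comp_apply, LinearEquiv.coe_coe,
          MulOpposite.coe_opLinearEquiv, MulOpposite.coe_opLinearEquiv_symm, MulOpposite.unop_op,
          AlgHom.toLinearMap_apply]
        generalize S.coact x = s
        induction s with
        | zero => simp
        | add x y hx hy => simp only [map_add, TensorProduct.add_tmul, hx, hy]
        | tmul x y => simp
    · clear h h'
      induction t with
      | zero => simp
      | add x y hx hy => simp only [map_add, hx, hy]
      | tmul x y => simp
  counit := by
    ext b
    induction b with | h b =>
    have h := LinearMap.congr_fun S.counit b
    simp only [LinearMap.comp_apply, LinearEquiv.coe_coe, AlgHom.toLinearMap_apply,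
      LinearMap.id_apply] at h ⊢
    simp only [MulOpposite.coe_opLinearEquiv_symm, MulOpposite.unop_op]
    rw [← congrArg MulOpposite.op h]
    clear h
    generalize S.coact b = t
    induction t with
    | zero => simp
    | add x y hx hy => simp only [map_add, hx, hy, MulOpposite.op_add]
    | tmul x y => simp
  map_one := by simp [Algebra.TensorProduct.one_def]
  map_mul a b := by
    induction a with | h a =>
    induction b with | h b =>
    simp only [LinearMap.comp_apply, LinearEquiv.coe_coe, AlgHom.toLinearMap_apply,
      MulOpposite.coe_opLinearEquiv_symm, MulOpposite.unop_op, MulOpposite.unop_mul, _root_.map_mul]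
    generalize S.coact a = s
    generalize S.coact b = t
    induction s with
    | zero => simp
    | add x y hx hy => simp only [map_add, mul_add, hx, hy, LinearMap.add_apply]
    | tmul x y =>
      induction t with
      | zero => simp
      | add x y hx hy => simp only [map_add, add_mul, hx, hy]
      | tmul z w => simp

variable {A : Type*} [Ring A] [Algebra k A]

/-- The bilinear map `(a, b) ↦ ∑ a₀ b₀ r(a₁ ⊗ b₁)`. -/
def ComodAlg.twistedMul (S : ComodAlg k H A) (r : H ⊗[k] H →ₗ[k] k) : A →ₗ[k] A →ₗ[k] A :=
  TensorProduct.curry (TensorProduct.rid k A ∘ₗ TensorProduct.map (LinearMap.mul' k A) r ∘ₗ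
    TensorProduct.tensorTensorTensorComm k A H A H ∘ₗ TensorProduct.map S.coact S.coact)

/-- `F(a # b)(c) = ∑ a c₀ b₀ r(c₁ ⊗ b₁)`. -/
def ComodAlg.F (S : ComodAlg k H A) (r : H ⊗[k] H →ₗ[k] k) : A ⊗[k] A →ₗ[k] Module.End k A :=
  TensorProduct.lift (LinearMap.mk₂ k
    (fun a b => LinearMap.mulLeft k a ∘ₗ (S.twistedMul r).flip b)
    (fun _ _ _ => by ext; simp [add_mul]) (fun _ _ _ => by ext; simp)
    (fun _ _ _ => by ext; simp [mul_add]) (fun _ _ _ => by ext; simp))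

/-- `G(a # b)(c) = ∑ r(a₁ ⊗ c₁) a₀ c₀ b`. -/
def ComodAlg.G (S : ComodAlg k H A) (r : H ⊗[k] H →ₗ[k] k) : A ⊗[k] A →ₗ[k] Module.End k A :=
  TensorProduct.lift (LinearMap.mk₂ k
    (fun a b => LinearMap.mulRight k b ∘ₗ S.twistedMul r a)
    (fun _ _ _ => by ext; simp [add_mul]) (fun _ _ _ => by ext; simp)
    (fun _ _ _ => by ext; simp [mul_add]) (fun _ _ _ => by ext; simp))

/-- `A` is `(H, r)`-Azumaya if `F : A # Ā → End A` and `G : Ā # A → (End A)^op` are isomorphisms.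
The underlying spaces of `A # Ā` and `Ā # A` are `A ⊗ A`; for a universal `r`-form `r` both maps
are automatically maps of comodule algebras, so being an isomorphism is being bijective. -/
def ComodAlg.IsAzumaya (S : ComodAlg k H A) (r : H ⊗[k] H →ₗ[k] k) : Prop :=
  Function.Bijective (S.F r) ∧ Function.Bijective (S.G r)

end Braided

/-- The ordered product `x_P` of the `x_j` with `j ∈ P`, taken in increasing order. -/
def ordProd {n : ℕ} {B : Type*} [Monoid B] (x : Fin n → B) (P : Finset (Fin n)) : B :=
  (P.sort.map x).prod

section Span

variable {k : Type*} [Field k] {n : ℕ} {B : Type*} [Ring B] [Algebra k B]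

theorem ordProd_insert {n : ℕ} {B : Type*} [Monoid B] (x : Fin n → B) {i : Fin n}
    {P : Finset (Fin n)} (h : ∀ j ∈ P, i < j) : ordProd x (insert i P) = x i * ordProd x P := by
  rw [ordProd, Finset.sort_insert (r := (· ≤ ·)) (fun b hb => (h b hb).le)
    (fun hi => lt_irrefl _ (h i hi))]
  simp [ordProd]

theorem mul_ordProd_mem (x : Fin n → B) (l : Fin n → k) (μ : Fin n → Fin n → k)
    (hx : ∀ i, x i * x i = algebraMap k B (l i))
    (hxx : ∀ i j, j < i → x i * x j + x j * x i = algebraMap k B (μ i j))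
    (i : Fin n) (P : Finset (Fin n)) :
    x i * ordProd x P ∈ Submodule.span k (ordProd x '' {Q | Q ⊆ insert i P}) := by
  induction P using Finset.induction_on_min with
  | empty =>
    refine Submodule.subset_span ⟨{i}, by simp, ?_⟩
    rw [← insert_empty_eq, ordProd_insert _ (by simp)]
  | insert j P hP ih =>
    rcases lt_trichotomy i j with hij | rfl | hij
    · refine Submodule.subset_span ⟨insert i (insert j P), by simp, ?_⟩
      rw [ordProd_insert x (i := i)]
      intro m hm
      rcases Finset.mem_insert.1 hm with rfl | hm
      · exact hij
      · exact hij.trans (hP m hm)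
    · rw [ordProd_insert x hP, ← mul_assoc, hx, ← Algebra.smul_def]
      refine Submodule.smul_mem _ _ (Submodule.subset_span ⟨P, ?_, rfl⟩)
      intro m hm
      simp [hm]
    · rw [ordProd_insert x hP, ← mul_assoc, eq_sub_of_add_eq (hxx i j hij), sub_mul,
        ← Algebra.smul_def, mul_assoc]
      refine Submodule.sub_mem _ (Submodule.smul_mem _ _ (Submodule.subset_span ⟨P, ?_, rfl⟩)) ?_
      · intro m hm
        simp [hm]
      · have h := Submodule.mem_map_of_mem (f := LinearMap.mulLeft k (x j)) ih
        rw [Submodule.map_span] at h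
        refine Submodule.span_mono ?_ h
        rintro _ ⟨_, ⟨Q, hQ, rfl⟩, rfl⟩
        have hQ' : Q ⊆ insert i P := hQ
        refine ⟨insert j Q, ?_, ?_⟩
        · intro m hm
          rcases Finset.mem_insert.1 hm with rfl | hm
          · simp
          · rcases Finset.mem_insert.1 (hQ' hm) with rfl | hm <;> simp [*]
        · rw [ordProd_insert]
          · simp
          · intro m hm
            rcases Finset.mem_insert.1 (hQ' hm) with rfl | hm
            · exact hij
            · exact hP m hm

/-- The words `c^a x_P` span every algebra generated by elements `c, x_1, …, x_n` whose squares
and anticommutators are scalars. -/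
theorem span_words (c : B) (x : Fin n → B) (α : k) (γ l : Fin n → k) (μ : Fin n → Fin n → k)
    (hc : c * c = algebraMap k B α) (hcx : ∀ i, c * x i + x i * c = algebraMap k B (γ i))
    (hx : ∀ i, x i * x i = algebraMap k B (l i))
    (hxx : ∀ i j, j < i → x i * x j + x j * x i = algebraMap k B (μ i j))
    (gen : Algebra.adjoin k (insert c (Set.range x)) = ⊤) :
    Submodule.span k (Set.range fun p : Fin 2 × Finset (Fin n) =>
      c ^ (p.1 : ℕ) * ordProd x p.2) = ⊤ := by
  set S := Submodule.span k (Set.range fun p : Fin 2 × Finset (Fin n) =>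
      c ^ (p.1 : ℕ) * ordProd x p.2) with hS
  have h0 : ∀ P, ordProd x P ∈ S := fun P => Submodule.subset_span ⟨(0, P), by simp⟩
  have h1 : ∀ P, c * ordProd x P ∈ S := fun P => Submodule.subset_span ⟨(1, P), by simp⟩
  have hxP : ∀ i P, x i * ordProd x P ∈ Submodule.span k (Set.range (ordProd x)) := fun i P =>
    Submodule.span_mono (Set.image_subset_range _ _) (mul_ordProd_mem x l μ hx hxx i P)
  have hle : Submodule.span k (Set.range (ordProd x)) ≤ S := by
    rw [Submodule.span_le]
    rintro _ ⟨P, rfl⟩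
    exact h0 P
  have hle' : ∀ y ∈ Submodule.span k (Set.range (ordProd x)), c * y ∈ S := by
    intro y hy
    induction hy using Submodule.span_induction with
    | mem y hy => obtain ⟨P, rfl⟩ := hy; exact h1 P
    | zero => simp
    | add y z _ _ hy hz => rw [mul_add]; exact S.add_mem hy hz
    | smul a y _ hy => rw [mul_smul_comm]; exact S.smul_mem _ hy
  have mulgen : ∀ g ∈ insert c (Set.range x), ∀ y ∈ S, g * y ∈ S := by
    intro g hg y hy
    induction hy using Submodule.span_induction with
    | zero => simp
    | add y z _ _ hy hz => rw [mul_add]; exact S.add_mem hy hz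
    | smul a y _ hy => rw [mul_smul_comm]; exact S.smul_mem _ hy
    | mem y hy =>
      obtain ⟨⟨a, P⟩, rfl⟩ := hy
      rcases hg with rfl | ⟨i, rfl⟩
      · fin_cases a
        · simpa using h1 P
        · simp only [pow_one]
          rw [← mul_assoc, hc, ← Algebra.smul_def]
          exact S.smul_mem _ (h0 P)
      · fin_cases a
        · simpa using hle (hxP i P)
        · simp only [pow_one]
          rw [← mul_assoc, eq_sub_of_add_eq' (hcx i), sub_mul, ← Algebra.smul_def, mul_assoc]
          exact S.sub_mem (S.smul_mem _ (h0 P)) (hle' _ (hxP i P))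
  have hone : (1 : B) ∈ S := by simpa [ordProd] using h0 ∅
  have key : ∀ b : B, ∀ y ∈ S, b * y ∈ S := by
    intro b
    have hb : b ∈ Algebra.adjoin k (insert c (Set.range x)) := gen ▸ Algebra.mem_top
    induction hb using Algebra.adjoin_induction with
    | mem g hg => exact mulgen g hg
    | algebraMap a => intro y hy; rw [← Algebra.smul_def]; exact S.smul_mem _ hy
    | add p q _ _ hp hq => intro y hy; rw [add_mul]; exact S.add_mem (hp y hy) (hq y hy)
    | mul p q _ _ hp hq => intro y hy; rw [mul_assoc]; exact hp _ (hq y hy)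
  rw [eq_top_iff]
  intro b _
  simpa using key b 1 hone

end Span

/-- The generators: one distinguished letter (`c`, resp. `u`) and `n` letters (`x_i`, resp. `v_i`). -/
inductive Gen (n : ℕ) : Type
  | g : Gen n
  | y (i : Fin n) : Gen n

section HopfAlgebraE

variable (k : Type u) [Field k] (n : ℕ)

/-- The defining relations of the algebra `E(n)`. -/
inductive ERel : FreeAlgebra k (Gen n) → FreeAlgebra k (Gen n) → Prop
  | c_sq : ERel (FreeAlgebra.ι k Gen.g * FreeAlgebra.ι k Gen.g) 1
  | cx (i : Fin n) : ERel (FreeAlgebra.ι k Gen.g * FreeAlgebra.ι k (Gen.y i) +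
      FreeAlgebra.ι k (Gen.y i) * FreeAlgebra.ι k Gen.g) 0
  | xx (i j : Fin n) : ERel (FreeAlgebra.ι k (Gen.y i) * FreeAlgebra.ι k (Gen.y j) +
      FreeAlgebra.ι k (Gen.y j) * FreeAlgebra.ι k (Gen.y i)) 0
  | x_sq (i : Fin n) : ERel (FreeAlgebra.ι k (Gen.y i) * FreeAlgebra.ι k (Gen.y i)) 0

/-- The algebra `E(n)` with generators `c, x_1, …, x_n` and relations
`c² = 1`, `c x_i + x_i c = 0`, `x_i x_j + x_j x_i = 0`, `x_i² = 0`. -/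
def E : Type u := RingQuot (ERel k n)

instance : Ring (E k n) := inferInstanceAs (Ring (RingQuot (ERel k n)))

instance : Algebra k (E k n) := inferInstanceAs (Algebra k (RingQuot (ERel k n)))

namespace E

def mk : FreeAlgebra k (Gen n) →ₐ[k] E k n := RingQuot.mkAlgHom k (ERel k n)

def c : E k n := mk k n (FreeAlgebra.ι k Gen.g)

variable {n} in
def x (i : Fin n) : E k n := mk k n (FreeAlgebra.ι k (Gen.y i))

theorem mk_rel {a b : FreeAlgebra k (Gen n)} (h : ERel k n a b) : mk k n a = mk k n b :=
  RingQuot.mkAlgHom_rel k h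

theorem c_mul_c : c k n * c k n = 1 := by
  simpa [c, x] using mk_rel k n ERel.c_sq

theorem c_x (i : Fin n) : c k n * x k i + x k i * c k n = 0 := by
  simpa [c, x] using mk_rel k n (ERel.cx i)

theorem x_x (i j : Fin n) : x k i * x k j + x k j * x k i = 0 := by
  simpa [c, x] using mk_rel k n (ERel.xx i j)

theorem x_mul_x (i : Fin n) : x k i * x k i = 0 := by
  simpa [c, x] using mk_rel k n (ERel.x_sq i)

variable {k n} {B : Type*} [Ring B] [Algebra k B]

/-- The universal property of `E(n)`. -/
def lift (c' : B) (x' : Fin n → B) (h₁ : c' * c' = 1) (h₂ : ∀ i, c' * x' i + x' i * c' = 0)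
    (h₃ : ∀ i j, x' i * x' j + x' j * x' i = 0) (h₄ : ∀ i, x' i * x' i = 0) : E k n →ₐ[k] B :=
  RingQuot.liftAlgHom k ⟨FreeAlgebra.lift k (fun t => match t with | Gen.g => c' | Gen.y i => x' i),
    by
      intro a b h
      cases h <;> simp [h₁, h₂, h₃, h₄]⟩

@[simp]
theorem lift_c (c' : B) (x' : Fin n → B) (h₁ h₂ h₃ h₄) :
    lift (k := k) c' x' h₁ h₂ h₃ h₄ (c k n) = c' := by
  refine (RingQuot.liftAlgHom_mkAlgHom_apply ..).trans ?_
  simp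

@[simp]
theorem lift_x (c' : B) (x' : Fin n → B) (h₁ h₂ h₃ h₄) (i : Fin n) :
    lift (k := k) c' x' h₁ h₂ h₃ h₄ (x k i) = x' i := by
  refine (RingQuot.liftAlgHom_mkAlgHom_apply ..).trans ?_
  simp

theorem algHom_ext {f g : E k n →ₐ[k] B} (hc : f (c k n) = g (c k n))
    (hx : ∀ i, f (x k i) = g (x k i)) : f = g := by
  refine RingQuot.ringQuot_ext' _ _ _ (FreeAlgebra.hom_ext ?_)
  funext t
  cases t
  · exact hc
  · exact hx _

variable (k n) in
theorem adjoin_eq_top : Algebra.adjoin k (insert (c k n) (Set.range (x (n := n) k))) = ⊤ := by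
  have h := congrArg (Subalgebra.map (mk k n)) (FreeAlgebra.adjoin_range_ι k (Gen n))
  rw [Algebra.map_top, (AlgHom.range_eq_top (mk k n)).2 (RingQuot.mkAlgHom_surjective k (ERel k n)),
    AlgHom.map_adjoin] at h
  rw [← h]
  congr 1
  ext b
  constructor
  · rintro (rfl | ⟨i, rfl⟩)
    · exact ⟨_, ⟨Gen.g, rfl⟩, rfl⟩
    · exact ⟨_, ⟨Gen.y i, rfl⟩, rfl⟩
  · rintro ⟨_, ⟨t, rfl⟩, rfl⟩
    cases t with
    | g => exact Or.inl rfl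
    | y i => exact Or.inr ⟨i, rfl⟩

variable (k n)

/-- `Δ(c) = c ⊗ c`, `Δ(x_i) = 1 ⊗ x_i + x_i ⊗ c`. -/
def comulHom : E k n →ₐ[k] E k n ⊗[k] E k n :=
  lift (c k n ⊗ₜ c k n) (fun i => 1 ⊗ₜ x k i + x k i ⊗ₜ c k n)
    (by simp [c_mul_c, Algebra.TensorProduct.one_def])
    (fun i => by
      have h : x k i * c k n = - (c k n * x k i) := eq_neg_of_add_eq_zero_right (c_x k n i)
      simp only [mul_add, add_mul, Algebra.TensorProduct.tmul_mul_tmul, one_mul, mul_one, h,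
        c_mul_c, TensorProduct.tmul_neg, TensorProduct.neg_tmul]
      abel)
    (fun i j => by
      have h : ∀ i, x k i * c k n = - (c k n * x k i) :=
        fun i => eq_neg_of_add_eq_zero_right (c_x k n i)
      have h' : x k i * x k j = - (x k j * x k i) := eq_neg_of_add_eq_zero_left (x_x k n i j)
      simp only [mul_add, add_mul, Algebra.TensorProduct.tmul_mul_tmul, one_mul, mul_one, h, h',
        c_mul_c, TensorProduct.tmul_neg, TensorProduct.neg_tmul]
      abel)
    (fun i => by
      have h : x k i * c k n = - (c k n * x k i) := eq_neg_of_add_eq_zero_right (c_x k n i)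
      simp [mul_add, add_mul, h, x_mul_x, TensorProduct.tmul_neg])

/-- `ε(c) = 1`, `ε(x_i) = 0`. -/
def counitHom : E k n →ₐ[k] k :=
  lift 1 (fun _ => 0) (by simp) (by simp) (by simp) (by simp)

instance : Bialgebra k (E k n) :=
  Bialgebra.ofAlgHom (comulHom k n) (counitHom k n)
    (algHom_ext (by simp [comulHom])
      (fun i => by
        simp [comulHom, TensorProduct.tmul_add, TensorProduct.add_tmul,
          Algebra.TensorProduct.one_def, add_assoc]))
    (algHom_ext (by simp [comulHom, counitHom]) (fun i => by simp [comulHom, counitHom]))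
    (algHom_ext (by simp [comulHom, counitHom]) (fun i => by simp [comulHom, counitHom]))

theorem comul_eq (a : E k n) : Coalgebra.comul (R := k) a = comulHom k n a := rfl

theorem counit_eq (a : E k n) : Coalgebra.counit (R := k) a = counitHom k n a := rfl

/-- The antipode as an algebra map to the opposite algebra: `S(c) = c`, `S(x_i) = c x_i`. -/
def antipodeHom : E k n →ₐ[k] (E k n)ᵐᵒᵖ :=
  lift (MulOpposite.op (c k n)) (fun i => MulOpposite.op (c k n * x k i))
    (by simp [← MulOpposite.op_mul, c_mul_c])
    (fun i => by
      have h : x k i * c k n = - (c k n * x k i) := eq_neg_of_add_eq_zero_right (c_x k n i)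
      rw [← MulOpposite.op_mul, ← MulOpposite.op_mul, mul_assoc, h, ← MulOpposite.op_add]
      simp)
    (fun i j => by
      have h : ∀ i, x k i * c k n = - (c k n * x k i) :=
        fun i => eq_neg_of_add_eq_zero_right (c_x k n i)
      have hm : ∀ i j, c k n * x k i * (c k n * x k j) = - (x k i * x k j) := by
        intro i j
        rw [mul_assoc, ← mul_assoc (x k i), h, neg_mul, mul_neg, ← mul_assoc, ← mul_assoc,
          c_mul_c, one_mul]
      rw [← MulOpposite.op_mul, ← MulOpposite.op_mul, hm, hm, ← MulOpposite.op_add, ← neg_add,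
        x_x]
      simp)
    (fun i => by
      have h : x k i * c k n = - (c k n * x k i) := eq_neg_of_add_eq_zero_right (c_x k n i)
      rw [← MulOpposite.op_mul, mul_assoc, ← mul_assoc (x k i), h, neg_mul, mul_assoc, x_mul_x]
      simp)

def antipodeMap : E k n →ₗ[k] E k n :=
  (MulOpposite.opLinearEquiv k).symm.toLinearMap ∘ₗ (antipodeHom k n).toLinearMap

theorem antipodeMap_mul (a b : E k n) :
    antipodeMap k n (a * b) = antipodeMap k n b * antipodeMap k n a := by
  simp [antipodeMap]

theorem antipodeMap_one : antipodeMap k n 1 = 1 := by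
  simp [antipodeMap]

theorem antipodeMap_c : antipodeMap k n (c k n) = c k n := by
  simp [antipodeMap, antipodeHom]

theorem antipodeMap_x (i : Fin n) : antipodeMap k n (x k i) = c k n * x k i := by
  simp [antipodeMap, antipodeHom]

theorem induction {p : E k n → Prop} (hc : p (c k n)) (hx : ∀ i, p (x k i))
    (halg : ∀ r : k, p (algebraMap k _ r)) (hadd : ∀ a b, p a → p b → p (a + b))
    (hmul : ∀ a b, p a → p b → p (a * b)) (a : E k n) : p a := by
  have ha : a ∈ Algebra.adjoin k (insert (c k n) (Set.range (x (n := n) k))) :=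
    adjoin_eq_top k n ▸ Algebra.mem_top
  induction ha using Algebra.adjoin_induction with
  | mem g hg =>
    rcases hg with rfl | ⟨i, rfl⟩
    · exact hc
    · exact hx i
  | algebraMap r => exact halg r
  | add a b _ _ ha hb => exact hadd a b ha hb
  | mul a b _ _ ha hb => exact hmul a b ha hb

theorem antipode_left_mul (s t : E k n ⊗[k] E k n) (e : k)
    (h : LinearMap.mul' k (E k n) ((antipodeMap k n).rTensor _ s) = algebraMap k _ e) :
    LinearMap.mul' k (E k n) ((antipodeMap k n).rTensor _ (s * t)) =
      algebraMap k _ e * LinearMap.mul' k (E k n) ((antipodeMap k n).rTensor _ t) := by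
  induction t with
  | zero => simp
  | add p q hp hq => simp only [mul_add, map_add, hp, hq]
  | tmul p q =>
    have key : LinearMap.mul' k (E k n) ((antipodeMap k n).rTensor _ (s * p ⊗ₜ q)) =
        antipodeMap k n p * LinearMap.mul' k (E k n) ((antipodeMap k n).rTensor _ s) * q := by
      clear h
      induction s with
      | zero => simp
      | add p q hp hq => simp only [mul_add, add_mul, map_add, hp, hq]
      | tmul a b => simp [antipodeMap_mul, mul_assoc]
    rw [key, h, ← Algebra.commutes, mul_assoc]
    simp

theorem antipode_right_mul (s t : E k n ⊗[k] E k n) (e : k)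
    (h : LinearMap.mul' k (E k n) ((antipodeMap k n).lTensor _ t) = algebraMap k _ e) :
    LinearMap.mul' k (E k n) ((antipodeMap k n).lTensor _ (s * t)) =
      LinearMap.mul' k (E k n) ((antipodeMap k n).lTensor _ s) * algebraMap k _ e := by
  induction s with
  | zero => simp
  | add p q hp hq => simp only [add_mul, map_add, hp, hq]
  | tmul p q =>
    have key : LinearMap.mul' k (E k n) ((antipodeMap k n).lTensor _ (p ⊗ₜ q * t)) =
        p * LinearMap.mul' k (E k n) ((antipodeMap k n).lTensor _ t) * antipodeMap k n q := by
      clear h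
      induction t with
      | zero => simp
      | add p q hp hq => simp only [mul_add, add_mul, map_add, hp, hq]
      | tmul a b => simp [antipodeMap_mul, mul_assoc]
    rw [key, h, mul_assoc, Algebra.commutes, ← mul_assoc]
    simp

theorem antipode_left (a : E k n) :
    LinearMap.mul' k (E k n) ((antipodeMap k n).rTensor _ (comulHom k n a)) =
      algebraMap k _ (counitHom k n a) := by
  induction a using induction with
  | hc => simp [comulHom, counitHom, antipodeMap_c, c_mul_c]
  | hx i =>
    have h : x k i * c k n = - (c k n * x k i) := eq_neg_of_add_eq_zero_right (c_x k n i)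
    have h' : c k n * (c k n * x k i) = x k i := by rw [← mul_assoc, c_mul_c, one_mul]
    simp [comulHom, counitHom, antipodeMap_x, antipodeMap_one, mul_assoc, h, h']
  | halg r =>
    simp [Algebra.TensorProduct.one_def, antipodeMap_one, Algebra.algebraMap_eq_smul_one]
  | hadd a b ha hb => simp only [map_add, ha, hb]
  | hmul a b ha hb => rw [map_mul, antipode_left_mul k n _ _ _ ha, hb, map_mul, map_mul]

theorem antipode_right (a : E k n) :
    LinearMap.mul' k (E k n) ((antipodeMap k n).lTensor _ (comulHom k n a)) =
      algebraMap k _ (counitHom k n a) := by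
  induction a using induction with
  | hc => simp [comulHom, counitHom, antipodeMap_c, c_mul_c]
  | hx i => simp [comulHom, counitHom, antipodeMap_x, antipodeMap_c, c_x]
  | halg r =>
    simp [Algebra.TensorProduct.one_def, antipodeMap_one, Algebra.algebraMap_eq_smul_one]
  | hadd a b ha hb => simp only [map_add, ha, hb]
  | hmul a b ha hb => rw [map_mul, antipode_right_mul k n _ _ _ hb, ha, map_mul, map_mul]

/-- The Hopf algebra `E(n)`. -/
instance : HopfAlgebra k (E k n) where
  antipode := antipodeMap k n
  mul_antipode_rTensor_comul := LinearMap.ext (antipode_left k n)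
  mul_antipode_lTensor_comul := LinearMap.ext (antipode_right k n)

section Basis

/-- The exterior algebra on `k^n`; it serves only to prove that the words `c^a x_P` are linearly
independent. -/
abbrev Ext := ExteriorAlgebra k (Fin n → k)

def repC : Module.End k (Ext k n × Ext k n) :=
  (CliffordAlgebra.involute.toLinearMap ∘ₗ LinearMap.snd k _ _).prod
    (CliffordAlgebra.involute.toLinearMap ∘ₗ LinearMap.fst k _ _)

variable {n} in
def repX (i : Fin n) : Module.End k (Ext k n × Ext k n) :=
  (LinearMap.mulLeft k (ExteriorAlgebra.ι k (Pi.single i 1))).prodMap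
    (LinearMap.mulLeft k (ExteriorAlgebra.ι k (Pi.single i 1)))

/-- A representation of `E(n)` on two copies of the exterior algebra. -/
def rep : E k n →ₐ[k] Module.End k (Ext k n × Ext k n) :=
  lift (repC k n) (repX k)
    (by
      refine LinearMap.ext fun p => ?_
      simp [repC])
    (fun i => by
      refine LinearMap.ext fun p => ?_
      have h : ∀ a : Ext k n, CliffordAlgebra.involute (ExteriorAlgebra.ι k (Pi.single i 1) * a) =
          - (ExteriorAlgebra.ι k (Pi.single i 1) * CliffordAlgebra.involute a) := by
        intro a
        rw [map_mul]
        erw [CliffordAlgebra.involute_ι]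
        rw [neg_mul]
      simp [repC, repX, h])
    (fun i j => by
      refine LinearMap.ext fun p => ?_
      simp only [repX, LinearMap.add_apply, Module.End.mul_apply, LinearMap.prodMap_apply,
        LinearMap.mulLeft_apply, ← mul_assoc, Prod.mk_add_mk, ← add_mul,
        ExteriorAlgebra.ι_add_mul_swap, zero_mul]
      rfl)
    (fun i => by
      refine LinearMap.ext fun p => ?_
      simp only [repX, Module.End.mul_apply, LinearMap.prodMap_apply,
        LinearMap.mulLeft_apply, ← mul_assoc, ExteriorAlgebra.ι_sq_zero, zero_mul]
      rfl)

theorem ext_basis (P : Finset (Fin n)) : (Pi.basisFun k (Fin n)).ExteriorAlgebra P =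
    ordProd (fun i => (ExteriorAlgebra.ι k (Pi.single i 1) : Ext k n)) P := by
  rw [ExteriorAlgebra.basis_apply_ofCard _ rfl, ordProd, ExteriorAlgebra.ιMulti_family,
    ExteriorAlgebra.ιMulti_apply, List.ofFn_eq_map,
    ← Finset.listMap_orderEmbOfFin_finRange P rfl, List.map_map]
  congr 2
  funext i
  simp [Set.powersetCard.ofFinEmbEquiv_symm_apply]

theorem rep_ordProd (P : Finset (Fin n)) : rep k n (ordProd (x k) P) (1, 0) =
    ((Pi.basisFun k (Fin n)).ExteriorAlgebra P, 0) := by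
  rw [ext_basis]
  induction P using Finset.induction_on_min with
  | empty => simp [ordProd]
  | insert i P hP ih =>
    rw [ordProd_insert _ hP, ordProd_insert _ hP, map_mul, Module.End.mul_apply, ih]
    simp [rep, repX]

/-- The basis `c^a x_P`, for `a ∈ {0, 1}` and `P ⊆ {1, …, n}`, of `E(n)`. -/
def basis : Module.Basis (Fin 2 × Finset (Fin n)) k (E k n) :=
  Module.Basis.mk (v := fun p => c k n ^ (p.1 : ℕ) * ordProd (x k) p.2)
    (by
      let b := (Pi.basisFun k (Fin n)).ExteriorAlgebra
      let ev : E k n →ₗ[k] Ext k n × Ext k n :=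
        LinearMap.applyₗ ((1 : Ext k n), (0 : Ext k n)) ∘ₗ (rep k n).toLinearMap
      have h0 : ∀ P, ev (c k n ^ ((0 : Fin 2) : ℕ) * ordProd (x k) P) = (b P, 0) := by
        intro P
        simp [ev, rep_ordProd, b]
      have h1 : ∀ P, ev (c k n ^ ((1 : Fin 2) : ℕ) * ordProd (x k) P) =
          (0, CliffordAlgebra.involute (b P)) := by
        intro P
        have : rep k n (c k n) = repC k n := by simp [rep]
        simp [ev, rep_ordProd, b, this, repC]
      refine LinearIndependent.of_pairwise_dual_eq_zero_one _
        (fun p => if p.1 = 0 then b.coord p.2 ∘ₗ LinearMap.fst k _ _ ∘ₗ ev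
          else b.coord p.2 ∘ₗ CliffordAlgebra.involute.toLinearMap ∘ₗ LinearMap.snd k _ _ ∘ₗ ev)
        ?_ ?_
      · rintro ⟨a, P⟩ ⟨a', P'⟩ hne
        have hone : (1 : Fin 2) ≠ 0 := by decide
        have ha : a = 0 ∨ a = 1 := by fin_cases a <;> simp
        have ha' : a' = 0 ∨ a' = 1 := by fin_cases a' <;> simp
        rcases ha with rfl | rfl <;> rcases ha' with rfl | rfl
        · have hP : P' ≠ P := fun h => hne (by rw [h])
          simp only [if_true, LinearMap.comp_apply, h0, LinearMap.fst_apply,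
            Module.Basis.coord_apply, Module.Basis.repr_self]
          exact Finsupp.single_eq_of_ne hP.symm
        · simp only [if_true, LinearMap.comp_apply, h1, LinearMap.fst_apply, map_zero]
        · simp only [if_neg hone, LinearMap.comp_apply, h0, LinearMap.snd_apply, map_zero]
        · have hP : P' ≠ P := fun h => hne (by rw [h])
          simp only [if_neg hone, LinearMap.comp_apply, h1, LinearMap.snd_apply,
            AlgHom.toLinearMap_apply, CliffordAlgebra.involute_involute,
            Module.Basis.coord_apply, Module.Basis.repr_self]
          exact Finsupp.single_eq_of_ne hP.symm
      · rintro ⟨a, P⟩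
        have hone : (1 : Fin 2) ≠ 0 := by decide
        have ha : a = 0 ∨ a = 1 := by fin_cases a <;> simp
        rcases ha with rfl | rfl
        · simp only [if_true, LinearMap.comp_apply, h0, LinearMap.fst_apply,
            Module.Basis.coord_apply, Module.Basis.repr_self, Finsupp.single_eq_same]
        · simp only [if_neg hone, LinearMap.comp_apply, h1, LinearMap.snd_apply,
            AlgHom.toLinearMap_apply, CliffordAlgebra.involute_involute,
            Module.Basis.coord_apply, Module.Basis.repr_self, Finsupp.single_eq_same])
    (span_words (c k n) (x k) 1 0 0 0 (by simp [c_mul_c]) (by simp [c_x]) (by simp [x_mul_x])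
      (by simp [x_x]) (adjoin_eq_top k n)).ge

@[simp]
theorem basis_apply (a : Fin 2) (P : Finset (Fin n)) :
    basis k n (a, P) = c k n ^ (a : ℕ) * ordProd (x k) P := by
  simp [basis]

end Basis

variable {k n}

/-- `∑_η sign(η) a_{p_1, f_{η(1)}} ⋯ a_{p_s, f_{η(s)}}` for `P = {p_1 < ⋯ < p_s}`,
`F = {f_1 < ⋯ < f_s}`, the sum being over all permutations `η` of `{1, …, s}`;
by convention `0` if `|F| ≠ |P|`. -/
def minorSum (A : Matrix (Fin n) (Fin n) k) (P F : Finset (Fin n)) : k :=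
  if h : F.card = P.card then
    ∑ η : Equiv.Perm (Fin P.card), ((Equiv.Perm.sign η : ℤ) : k) *
      ∏ i, A (P.orderEmbOfFin rfl i) (F.orderEmbOfFin h (η i))
  else 0

/-- The functionals `(x_P)^*` of the dual basis. -/
def xDual (P : Finset (Fin n)) : Module.Dual k (E k n) := (basis k n).coord (0, P)

/-- The functionals `(c x_P)^*` of the dual basis. -/
def cxDual (P : Finset (Fin n)) : Module.Dual k (E k n) := (basis k n).coord (1, P)

/-- The universal `r`-form `r_A` of `E(n)` attached to a matrix `A`. -/
def rForm (A : Matrix (Fin n) (Fin n) k) : E k n ⊗[k] E k n →ₗ[k] k :=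
  TensorProduct.dualDistrib k (E k n) (E k n)
    (∑ P : Finset (Fin n), (-1 : k) ^ (P.card * (P.card - 1) / 2) •
      ∑ F : Finset (Fin n), minorSum A P F •
        (xDual P ⊗ₜ[k] xDual F + cxDual P ⊗ₜ[k] xDual F +
          (-1 : k) ^ P.card • xDual P ⊗ₜ[k] cxDual F -
          (-1 : k) ^ P.card • cxDual P ⊗ₜ[k] cxDual F))

end E

end HopfAlgebraE

section Clifford

variable {k : Type u} [Field k] {n : ℕ}

/-- The defining relations of the generalized Clifford algebra. Only the entries `Λ i j` with
`j ≤ i` occur (`Λ` is lower triangular). -/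
inductive ClRel (α : k) (γ : Fin n → k) (Λ : Matrix (Fin n) (Fin n) k) :
    FreeAlgebra k (Gen n) → FreeAlgebra k (Gen n) → Prop
  | u_sq : ClRel α γ Λ (FreeAlgebra.ι k Gen.g * FreeAlgebra.ι k Gen.g)
      (algebraMap k (FreeAlgebra k (Gen n)) α)
  | uv (i : Fin n) : ClRel α γ Λ (FreeAlgebra.ι k Gen.g * FreeAlgebra.ι k (Gen.y i) +
      FreeAlgebra.ι k (Gen.y i) * FreeAlgebra.ι k Gen.g)
      (algebraMap k (FreeAlgebra k (Gen n)) (γ i))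
  | v_sq (i : Fin n) : ClRel α γ Λ (FreeAlgebra.ι k (Gen.y i) * FreeAlgebra.ι k (Gen.y i))
      (algebraMap k (FreeAlgebra k (Gen n)) (Λ i i))
  | vv (i j : Fin n) (h : j < i) : ClRel α γ Λ
      (FreeAlgebra.ι k (Gen.y i) * FreeAlgebra.ι k (Gen.y j) +
        FreeAlgebra.ι k (Gen.y j) * FreeAlgebra.ι k (Gen.y i))
      (algebraMap k (FreeAlgebra k (Gen n)) (Λ i j))

/-- The generalized Clifford algebra `Cl(α, γ, Λ)` with generators `u, v_1, …, v_n` and relations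
`u² = α`, `u v_i + v_i u = γ_i`, `v_i² = λ_ii`, `v_i v_j + v_j v_i = λ_ij` for `j < i`. -/
def Cl (α : k) (γ : Fin n → k) (Λ : Matrix (Fin n) (Fin n) k) : Type u := RingQuot (ClRel α γ Λ)

variable (α : k) (γ : Fin n → k) (Λ : Matrix (Fin n) (Fin n) k)

instance : Ring (Cl α γ Λ) := inferInstanceAs (Ring (RingQuot (ClRel α γ Λ)))

instance : Algebra k (Cl α γ Λ) := inferInstanceAs (Algebra k (RingQuot (ClRel α γ Λ)))

namespace Cl

def mk : FreeAlgebra k (Gen n) →ₐ[k] Cl α γ Λ := RingQuot.mkAlgHom k (ClRel α γ Λ)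

def u : Cl α γ Λ := mk α γ Λ (FreeAlgebra.ι k Gen.g)

def v (i : Fin n) : Cl α γ Λ := mk α γ Λ (FreeAlgebra.ι k (Gen.y i))

theorem mk_rel {a b : FreeAlgebra k (Gen n)} (h : ClRel α γ Λ a b) :
    mk α γ Λ a = mk α γ Λ b :=
  RingQuot.mkAlgHom_rel k h

theorem u_mul_u : u α γ Λ * u α γ Λ = algebraMap k _ α := by
  simpa [u] using mk_rel α γ Λ ClRel.u_sq

theorem u_v (i : Fin n) :
    u α γ Λ * v α γ Λ i + v α γ Λ i * u α γ Λ = algebraMap k _ (γ i) := by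
  simpa [u, v] using mk_rel α γ Λ (ClRel.uv i)

theorem v_mul_v (i : Fin n) : v α γ Λ i * v α γ Λ i = algebraMap k _ (Λ i i) := by
  simpa [v] using mk_rel α γ Λ (ClRel.v_sq i)

theorem v_v (i j : Fin n) (h : j < i) :
    v α γ Λ i * v α γ Λ j + v α γ Λ j * v α γ Λ i = algebraMap k _ (Λ i j) := by
  simpa [v] using mk_rel α γ Λ (ClRel.vv i j h)

variable {α γ Λ} {B : Type*} [Ring B] [Algebra k B]

/-- The universal property of `Cl(α, γ, Λ)`. -/
def lift (u' : B) (v' : Fin n → B) (h₁ : u' * u' = algebraMap k B α)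
    (h₂ : ∀ i, u' * v' i + v' i * u' = algebraMap k B (γ i))
    (h₃ : ∀ i, v' i * v' i = algebraMap k B (Λ i i))
    (h₄ : ∀ i j, j < i → v' i * v' j + v' j * v' i = algebraMap k B (Λ i j)) :
    Cl α γ Λ →ₐ[k] B :=
  RingQuot.liftAlgHom k ⟨FreeAlgebra.lift k (fun t => match t with | Gen.g => u' | Gen.y i => v' i),
    by
      intro a b h
      cases h with
      | u_sq => simp [h₁]
      | uv i => simp [h₂]
      | v_sq i => simp [h₃]
      | vv i j h => simp [h₄ i j h]⟩

@[simp]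
theorem lift_u (u' : B) (v' : Fin n → B) (h₁ h₂ h₃ h₄) :
    lift (α := α) (γ := γ) (Λ := Λ) u' v' h₁ h₂ h₃ h₄ (u α γ Λ) = u' := by
  refine (RingQuot.liftAlgHom_mkAlgHom_apply ..).trans ?_
  simp

@[simp]
theorem lift_v (u' : B) (v' : Fin n → B) (h₁ h₂ h₃ h₄) (i : Fin n) :
    lift (α := α) (γ := γ) (Λ := Λ) u' v' h₁ h₂ h₃ h₄ (v α γ Λ i) = v' i := by
  refine (RingQuot.liftAlgHom_mkAlgHom_apply ..).trans ?_
  simp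

theorem algHom_ext {f g : Cl α γ Λ →ₐ[k] B} (hu : f (u α γ Λ) = g (u α γ Λ))
    (hv : ∀ i, f (v α γ Λ i) = g (v α γ Λ i)) : f = g := by
  refine RingQuot.ringQuot_ext' _ _ _ (FreeAlgebra.hom_ext ?_)
  funext t
  cases t
  · exact hu
  · exact hv _

variable (α γ Λ)

theorem adjoin_eq_top :
    Algebra.adjoin k (insert (u α γ Λ) (Set.range (v α γ Λ))) = ⊤ := by
  have h := congrArg (Subalgebra.map (mk α γ Λ)) (FreeAlgebra.adjoin_range_ι k (Gen n))
  rw [Algebra.map_top,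
    (AlgHom.range_eq_top (mk α γ Λ)).2 (RingQuot.mkAlgHom_surjective k (ClRel α γ Λ)),
    AlgHom.map_adjoin] at h
  rw [← h]
  congr 1
  ext b
  constructor
  · rintro (rfl | ⟨i, rfl⟩)
    · exact ⟨_, ⟨Gen.g, rfl⟩, rfl⟩
    · exact ⟨_, ⟨Gen.y i, rfl⟩, rfl⟩
  · rintro ⟨_, ⟨t, rfl⟩, rfl⟩
    cases t with
    | g => exact Or.inl rfl
    | y i => exact Or.inr ⟨i, rfl⟩

instance : Module.Finite k (Cl α γ Λ) :=
  Module.finite_def.2 (Submodule.fg_def.2 ⟨_, Set.finite_range _,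
    span_words (u α γ Λ) (v α γ Λ) α γ (fun i => Λ i i) Λ (u_mul_u α γ Λ) (u_v α γ Λ)
      (v_mul_v α γ Λ) (v_v α γ Λ) (adjoin_eq_top α γ Λ)⟩)

/-- The coaction `ρ(u) = u ⊗ c`, `ρ(v_i) = 1 ⊗ x_i + v_i ⊗ c`. -/
def coactHom : Cl α γ Λ →ₐ[k] Cl α γ Λ ⊗[k] E k n :=
  lift (u α γ Λ ⊗ₜ E.c k n) (fun i => 1 ⊗ₜ E.x k i + v α γ Λ i ⊗ₜ E.c k n)
    (by simp [u_mul_u, E.c_mul_c, Algebra.TensorProduct.algebraMap_apply])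
    (fun i => by
      have h : E.x k i * E.c k n = - (E.c k n * E.x k i) :=
        eq_neg_of_add_eq_zero_right (E.c_x k n i)
      rw [Algebra.TensorProduct.algebraMap_apply, ← u_v]
      simp only [mul_add, add_mul, Algebra.TensorProduct.tmul_mul_tmul, one_mul, mul_one, h,
        E.c_mul_c, TensorProduct.tmul_neg, TensorProduct.add_tmul]
      abel)
    (fun i => by
      have h : E.x k i * E.c k n = - (E.c k n * E.x k i) :=
        eq_neg_of_add_eq_zero_right (E.c_x k n i)
      rw [Algebra.TensorProduct.algebraMap_apply, ← v_mul_v]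
      simp [mul_add, add_mul, h, E.x_mul_x, E.c_mul_c, TensorProduct.tmul_neg])
    (fun i j hij => by
      have h : ∀ i, E.x k i * E.c k n = - (E.c k n * E.x k i) :=
        fun i => eq_neg_of_add_eq_zero_right (E.c_x k n i)
      have h' : E.x k i * E.x k j = - (E.x k j * E.x k i) :=
        eq_neg_of_add_eq_zero_left (E.x_x k n i j)
      rw [Algebra.TensorProduct.algebraMap_apply, ← v_v α γ Λ i j hij]
      simp only [mul_add, add_mul, Algebra.TensorProduct.tmul_mul_tmul, one_mul, mul_one, h, h',
        E.c_mul_c, TensorProduct.tmul_neg, TensorProduct.add_tmul]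
      abel)

theorem coactHom_u : coactHom α γ Λ (u α γ Λ) = u α γ Λ ⊗ₜ E.c k n :=
  lift_u ..

theorem coactHom_v (i : Fin n) :
    coactHom α γ Λ (v α γ Λ i) = 1 ⊗ₜ E.x k i + v α γ Λ i ⊗ₜ E.c k n :=
  lift_v ..

/-- `Cl(α, γ, Λ)` as a right `E(n)`-comodule algebra. -/
def comoduleAlgebra : RightComoduleAlgebra k (E k n) (Cl α γ Λ) where
  coact := coactHom α γ Λ
  coassoc := by
    have h : (Algebra.TensorProduct.assoc k k k (Cl α γ Λ) (E k n) (E k n)).toAlgHom.comp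
        ((Algebra.TensorProduct.map (coactHom α γ Λ) (.id k _)).comp (coactHom α γ Λ)) =
        (Algebra.TensorProduct.map (.id k _) (E.comulHom k n)).comp (coactHom α γ Λ) :=
      algHom_ext (by simp [coactHom_u, coactHom_v, E.comulHom])
        (fun i => by
          simp [coactHom_u, coactHom_v, E.comulHom, TensorProduct.tmul_add, TensorProduct.add_tmul,
            Algebra.TensorProduct.one_def, add_assoc])
    exact congrArg AlgHom.toLinearMap h
  counit := by
    have h : (Algebra.TensorProduct.rid k k (Cl α γ Λ)).toAlgHom.comp
        ((Algebra.TensorProduct.map (.id k _) (E.counitHom k n)).comp (coactHom α γ Λ)) =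
        .id k _ :=
      algHom_ext (by simp [coactHom_u, coactHom_v, E.counitHom]) (fun i => by simp [coactHom_u, coactHom_v, E.counitHom])
    exact congrArg AlgHom.toLinearMap h

end Cl

end Clifford

end HopfE

end

/-! Write `B` for the Clifford algebra, R_x for right multiplication by x, and Φ_y(d) = ∑ r_A(d₁ ⊗
y₁) y₀ d₀. For the opposite algebra, the map F becomes x ⊗ y ↦ R_x Φ_y. Its source and target have
equal finite dimension, so F is bijective exactly when the operators R_x Φ_y span End B.

Two rules determine r_A. A factor c on the left of the second argument applies the sign involution
to the first argument; a factor x_j applies the skew derivation x_i ↦ a_ij (`E.rForm_x_mul_right`,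
at heart the expansion of a minor along a column). Transported through the coaction, they become
Φ_{w_i x}(d) = Φ_x(D_i d) + w_i Φ_x(σ d) for the generators w_i of `B`. `TwistedAction` isolates
this situation.

Let b be the matrix of anticommutators of the generators and let a_ij = D_j(w_i). The operators C_i
= R_{w_i} - Φ_{w_i} kill 1, anticommute with each other, and satisfy C_i R_{w_j} + R_{w_j} C_i = (b
- aᵀ)_ij. If b - aᵀ is invertible, combinations of the C_i are annihilation operators dual to the
R_{w_j}; correcting the R_{w_j} by annihilators makes them creation operators, with vacuum 1. Such a
Fock representation generates all of End B (`subalgebra_eq_top_of_clifford`,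
`TwistedAction.span_eq_top`). Conversely, a kernel vector t gives z = ∑ t_i w_i whose left
multiplication commutes with every R_x Φ_y. If these spanned End B, z would be a scalar, which
linear independence of 1 and the generators excludes unless t = 0
(`TwistedAction.det_ne_zero_of_span_eq_top`). The Schur complement of the entry 2α turns det(b - aᵀ)
into the stated determinant, up to a nonzero factor.

Reversal of words swaps the arguments of the r-form and replaces A by Aᵀ, so G for A is equivalent
to F for Aᵀ. The criterion does not change, because Λ + Λᵗ and Γ are symmetric. -/

noncomputable section

namespace HopfE

/-! ### Fock space criteria for generating an endomorphism algebra -/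

section Fock

variable {k : Type*} [Field k] {V : Type*} [AddCommGroup V] [Module k V]
  {ι : Type*}

/-- A subalgebra of `End V` which contains an operator `e` projecting onto the line spanned by a
cyclic vector `Ω`, and which has no nonzero vector `x` with `e T x = 0` for all `T` in it, is
everything. -/
theorem subalgebra_eq_top_of_rank_one [Module.Finite k V] (𝒜 : Subalgebra k (Module.End k V))
    (Ω : V) (cyc : ∀ x : V, ∃ T ∈ 𝒜, T Ω = x) (e : Module.End k V) (he : e ∈ 𝒜)
    (ℓ : Module.Dual k V) (heℓ : ∀ x, e x = ℓ x • Ω)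
    (hsep : ∀ x, (∀ T ∈ 𝒜, ℓ (T x) = 0) → x = 0) : 𝒜 = ⊤ := by
  -- The functionals ℓ ∘ T with T in 𝒜 have no common zero, so in finite dimension they fill the
  -- dual space.
  have hW : Submodule.map (LinearMap.compRight k ℓ (M := V)) 𝒜.toSubmodule = ⊤ := by
    have h0 : (Submodule.map (LinearMap.compRight k ℓ (M := V))
        𝒜.toSubmodule).dualCoannihilator = ⊥ := by
      rw [eq_bot_iff]
      intro x hx
      rw [Submodule.mem_dualCoannihilator] at hx
      exact hsep x fun T hT => hx _ ⟨T, hT, rfl⟩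
    have h1 := Subspace.dualCoannihilator_dualAnnihilator_eq (K := k) (V := V)
      (W := Submodule.map (LinearMap.compRight k ℓ (M := V)) 𝒜.toSubmodule)
    rw [← h1, h0, Submodule.dualAnnihilator_bot]
  -- Every rank-one operator factors as T e T', where T moves Ω to the required vector and ℓ ∘ T' is
  -- the required functional.
  have key : ∀ (φ : Module.Dual k V) (y : V), φ.smulRight y ∈ 𝒜 := by
    intro φ y
    obtain ⟨T, hT, rfl⟩ := cyc y
    obtain ⟨T', hT', rfl⟩ := (hW ▸ Submodule.mem_top : φ ∈ _)
    have : (LinearMap.compRight k ℓ T' : Module.Dual k V).smulRight (T Ω) = T * e * T' := by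
      ext x
      simp [heℓ]
    rw [this]
    exact 𝒜.mul_mem (𝒜.mul_mem hT he) hT'
  rw [eq_top_iff]
  intro T _
  let B := Module.finBasis k V
  have : T = ∑ i, (B.coord i).smulRight (T (B i)) := by
    refine B.ext fun j => ?_
    simp [Finsupp.single_apply]
  rw [this]
  exact 𝒜.sum_mem fun i _ => key _ _

variable [Fintype ι] [DecidableEq ι]

/-- Operators satisfying the canonical anticommutation relations, acting on a module generated by
a vacuum vector, generate the whole endomorphism algebra. -/
theorem subalgebra_eq_top_of_car [Module.Finite k V] (C D : ι → Module.End k V)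
    (hC : ∀ i, C i * C i = 0) (hCC : ∀ i j, C i * C j + C j * C i = 0)
    (hD : ∀ i, D i * D i = 0) (hDD : ∀ i j, D i * D j + D j * D i = 0)
    (hDC : ∀ i j, D i * C j + C j * D i = if i = j then 1 else 0)
    (Ω : V) (hΩ : ∀ i, D i Ω = 0)
    (cyc : ∀ W : Submodule k V, Ω ∈ W → (∀ i, ∀ x ∈ W, C i x ∈ W) → (∀ i, ∀ x ∈ W, D i x ∈ W) →
      W = ⊤)
    (𝒜 : Subalgebra k (Module.End k V)) (h𝒜C : ∀ i, C i ∈ 𝒜) (h𝒜D : ∀ i, D i ∈ 𝒜) : 𝒜 = ⊤ := by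
  have hDC' : ∀ i j x, D i (C j x) = (if i = j then x else 0) - C j (D i x) := by
    intro i j x
    have h := LinearMap.congr_fun (hDC i j) x
    rw [eq_sub_iff_add_eq]
    refine h.trans ?_
    split_ifs <;> simp
  -- every vector is a multiple of the vacuum plus created vectors
  have words : ∀ x : V, x ∈ Submodule.span k
      (Set.range fun l : List ι => (l.map C).prod Ω) := by
    have : Submodule.span k (Set.range fun l : List ι => (l.map C).prod Ω) = ⊤ := by
      refine cyc _ (Submodule.subset_span ⟨[], by simp⟩) ?_ ?_
      · intro i x hx
        induction hx using Submodule.span_induction with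
        | mem x hx => obtain ⟨l, rfl⟩ := hx; exact Submodule.subset_span ⟨i :: l, by simp⟩
        | zero => simp
        | add x y _ _ hx hy => rw [map_add]; exact Submodule.add_mem _ hx hy
        | smul a x _ hx => rw [map_smul]; exact Submodule.smul_mem _ _ hx
      · intro i x hx
        induction hx using Submodule.span_induction with
        | zero => simp
        | add x y _ _ hx hy => rw [map_add]; exact Submodule.add_mem _ hx hy
        | smul a x _ hx => rw [map_smul]; exact Submodule.smul_mem _ _ hx
        | mem x hx =>
          obtain ⟨l, rfl⟩ := hx
          induction l with
          | nil => simp [hΩ]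
          | cons j l ih =>
            simp only [List.map_cons, List.prod_cons, Module.End.mul_apply, hDC'] at ih ⊢
            refine Submodule.sub_mem _ ?_ ?_
            · split_ifs
              · exact Submodule.subset_span ⟨l, rfl⟩
              · exact Submodule.zero_mem _
            · generalize D i ((List.map C l).prod Ω) = y at ih
              induction ih using Submodule.span_induction with
              | mem x hx =>
                obtain ⟨l, rfl⟩ := hx
                exact Submodule.subset_span ⟨j :: l, by simp⟩
              | zero => simp
              | add x y _ _ hx hy => rw [map_add]; exact Submodule.add_mem _ hx hy
              | smul a x _ hx => rw [map_smul]; exact Submodule.smul_mem _ _ hx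
    intro x
    rw [this]
    trivial
  -- the projection onto the vacuum
  have proj : ∀ S : Finset ι, ∃ e ∈ 𝒜, e Ω = Ω ∧ (∀ i ∈ S, e * C i = 0) ∧
      ∀ x, (∀ i ∈ S, D i x = 0) → e x = x := by
    intro S
    induction S using Finset.induction_on with
    | empty => exact ⟨1, 𝒜.one_mem, by simp, by simp, by simp⟩
    | insert j S hj ih =>
      obtain ⟨e, he, heΩ, heC, heD⟩ := ih
      -- D_j C_j kills the image of C_j, fixes the kernel of D_j, and commutes with C_i for i ≠ j
      -- (two sign changes). The projection is the product of these factors.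
      refine ⟨e * (D j * C j), 𝒜.mul_mem he (𝒜.mul_mem (h𝒜D j) (h𝒜C j)), ?_, ?_, ?_⟩
      · simp [hDC', hΩ, heΩ]
      · intro i hi
        by_cases hij : i = j
        · subst hij
          rw [mul_assoc, mul_assoc, hC, mul_zero, mul_zero]
        · have hi' := heC i (Finset.mem_of_mem_insert_of_ne hi hij)
          have h1 : C j * C i = - (C i * C j) := eq_neg_of_add_eq_zero_left (hCC j i)
          have h2 : D j * C i = - (C i * D j) :=
            eq_neg_of_add_eq_zero_left (by rw [hDC, if_neg (Ne.symm hij)])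
          rw [mul_assoc, mul_assoc, h1, mul_neg, ← mul_assoc (D j), h2, neg_mul, neg_neg,
            mul_assoc, ← mul_assoc e, hi', zero_mul]
      · intro x hx
        have := heD x fun i hi => hx i (Finset.mem_insert_of_mem hi)
        simp [hDC', hx j (Finset.mem_insert_self _ _), this]
  obtain ⟨e, he, heΩ, heC, heD⟩ := proj Finset.univ
  have heline : ∀ x, ∃ s : k, e x = s • Ω := by
    intro x
    have hx := words x
    induction hx using Submodule.span_induction with
    | mem x hx =>
      obtain ⟨l, rfl⟩ := hx
      cases l with
      | nil => exact ⟨1, by simp [heΩ]⟩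
      | cons i l =>
        refine ⟨0, ?_⟩
        simpa using LinearMap.congr_fun (heC i (Finset.mem_univ _)) ((l.map C).prod Ω)
    | zero => exact ⟨0, by simp⟩
    | add x y _ _ hx hy =>
      obtain ⟨s, hs⟩ := hx
      obtain ⟨t, ht⟩ := hy
      exact ⟨s + t, by rw [map_add, hs, ht, add_smul]⟩
    | smul a x _ hx =>
      obtain ⟨s, hs⟩ := hx
      exact ⟨a * s, by rw [map_smul, hs, mul_smul]⟩
  -- A zero vacuum forces V = 0; this case is split off so that a functional with value 1 at Ω
  -- exists.
  by_cases hΩ0 : Ω = 0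
  · have hV : ∀ x : V, x = 0 := by
      intro x
      have h := cyc ⊥ (by simp [hΩ0]) (by simp) (by simp)
      have hx : x ∈ (⊥ : Submodule k V) := h ▸ Submodule.mem_top
      simpa using hx
    rw [eq_top_iff]
    intro T _
    have : T = 0 := LinearMap.ext fun x => hV _
    rw [this]
    exact 𝒜.zero_mem
  obtain ⟨ℓ, hℓ⟩ := Module.Projective.exists_dual_eq_one k hΩ0
  have heℓ : ∀ x, e x = (ℓ ∘ₗ e) x • Ω := by
    intro x
    obtain ⟨s, hs⟩ := heline x
    simp [hs, hℓ]
  refine subalgebra_eq_top_of_rank_one 𝒜 Ω ?_ e he (ℓ ∘ₗ e) heℓ ?_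
  · intro x
    have hx := words x
    induction hx using Submodule.span_induction with
    | mem x hx =>
      obtain ⟨l, rfl⟩ := hx
      refine ⟨_, 𝒜.list_prod_mem ?_, rfl⟩
      intro T hT
      obtain ⟨i, -, rfl⟩ := List.mem_map.1 hT
      exact h𝒜C i
    | zero => exact ⟨0, 𝒜.zero_mem, by simp⟩
    | add x y _ _ hx hy =>
      obtain ⟨S, hS, rfl⟩ := hx
      obtain ⟨T, hT, rfl⟩ := hy
      exact ⟨S + T, 𝒜.add_mem hS hT, by simp⟩
    | smul a x _ hx =>
      obtain ⟨T, hT, rfl⟩ := hx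
      exact ⟨a • T, 𝒜.smul_mem hT a, by simp⟩
  -- S bounds the annihilators that may act nontrivially on x. Applying D_j removes j from S, since
  -- D_j² = 0 and the others anticommute with it; when S is empty, x = e x is a multiple of Ω with
  -- coefficient 0.
  · have sep : ∀ (S : Finset ι) (x : V), (∀ T ∈ 𝒜, (ℓ ∘ₗ e) (T x) = 0) →
        (∀ i ∉ S, D i x = 0) → x = 0 := by
      intro S
      induction S using Finset.induction_on with
      | empty =>
        intro x hx hDx
        have h := heℓ x
        have h1 := hx 1 𝒜.one_mem
        rw [Module.End.one_apply] at h1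
        rw [heD x fun i _ => hDx i (Finset.notMem_empty i), h1, zero_smul] at h
        exact h
      | insert j S _ ih =>
        intro x hx hDx
        refine ih x hx fun i hi => ?_
        by_cases hij : i = j
        · subst hij
          refine ih _ (fun T hT => hx (T * D i) (𝒜.mul_mem hT (h𝒜D i))) fun l hl => ?_
          by_cases hil : l = i
          · subst hil
            exact LinearMap.congr_fun (hD l) x
          · have h := LinearMap.congr_fun (hDD l i) x
            simpa [hDx l (by simp [hil, hl])] using h
        · exact hDx i (by simp [hij, hi])
    exact fun x hx => sep Finset.univ x hx (by simp)

/-- Operators `R i` satisfying Clifford relations together with anticommuting operators `C i`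
which pair with them through an invertible matrix and annihilate a cyclic vector generate the whole
endomorphism algebra. -/
theorem subalgebra_eq_top_of_clifford [Module.Finite k V] (h2 : (2 : k) ≠ 0)
    (R C : ι → Module.End k V) (b M : Matrix ι ι k) (hM : M.det ≠ 0)
    (hR : ∀ i j, R i * R j + R j * R i = b i j • 1)
    (hCC : ∀ i j, C i * C j + C j * C i = 0)
    (hCR : ∀ i j, C i * R j + R j * C i = M i j • 1)
    (Ω : V) (hΩ : ∀ i, C i Ω = 0)
    (cyc : ∀ W : Submodule k V, Ω ∈ W → (∀ i, ∀ x ∈ W, R i x ∈ W) → W = ⊤)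
    (𝒜 : Subalgebra k (Module.End k V)) (h𝒜R : ∀ i, R i ∈ 𝒜) (h𝒜C : ∀ i, C i ∈ 𝒜) : 𝒜 = ⊤ := by
  have hsq : ∀ T : Module.End k V, T * T + T * T = 0 → T * T = 0 := by
    intro T hT
    rw [← two_smul k] at hT
    exact (smul_eq_zero.1 hT).resolve_left h2
  -- Multiplying by the inverse matrix makes the annihilators dual to the R_j.
  let D : ι → Module.End k V := fun i => ∑ l, M⁻¹ i l • C l
  -- The correction changes the anticommutator of R_i and R_j by -b_ij/2 - b_ji/2 = -b_ij, so the
  -- N_i anticommute. It does not affect the pairing with D, because the D_i anticommute.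
  let N : ι → Module.End k V := fun i => R i - (2⁻¹ : k) • ∑ l, b i l • D l
  have hDC : ∀ i j, D i * C j + C j * D i = 0 := by
    intro i j
    simp only [D, Finset.sum_mul, Finset.mul_sum, smul_mul_assoc, mul_smul_comm,
      ← Finset.sum_add_distrib, ← smul_add, hCC, smul_zero, Finset.sum_const_zero]
  have hDD : ∀ i j, D i * D j + D j * D i = 0 := by
    intro i j
    have : D i * D j + D j * D i = ∑ l, M⁻¹ j l • (D i * C l + C l * D i) := by
      simp only [D, Finset.sum_mul _ _ (∑ l, M⁻¹ i l • C l),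
        Finset.mul_sum _ _ (∑ l, M⁻¹ i l • C l), smul_mul_assoc, mul_smul_comm,
        ← Finset.sum_add_distrib, ← smul_add]
    simp [this, hDC]
  have hDR : ∀ i j, D i * R j + R j * D i = if i = j then 1 else 0 := by
    intro i j
    have hMM : M⁻¹ * M = 1 := Matrix.nonsing_inv_mul M (isUnit_iff_ne_zero.2 hM)
    have h : (M⁻¹ * M) i j • (1 : Module.End k V) = if i = j then 1 else 0 := by
      rw [hMM, Matrix.one_apply]
      split_ifs <;> simp
    rw [← h, Matrix.mul_apply, Finset.sum_smul]
    simp only [D, Finset.sum_mul, Finset.mul_sum, smul_mul_assoc, mul_smul_comm,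
      ← Finset.sum_add_distrib, ← smul_add, hCR, mul_smul]
  have hDN : ∀ i j, D i * N j + N j * D i = if i = j then 1 else 0 := by
    intro i j
    have : D i * N j + N j * D i =
        D i * R j + R j * D i - (2⁻¹ : k) • ∑ l, b j l • (D i * D l + D l * D i) := by
      simp only [N, mul_sub, sub_mul, smul_mul_assoc, mul_smul_comm, Finset.sum_mul,
        Finset.mul_sum, smul_add, Finset.sum_add_distrib]
      abel
    simp [this, hDD, hDR]
  have hsum : ∀ i j, (∑ l, b i l • D l) * R j + R j * (∑ l, b i l • D l) = b i j • 1 := by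
    intro i j
    simp only [Finset.sum_mul, Finset.mul_sum, smul_mul_assoc, mul_smul_comm,
      ← Finset.sum_add_distrib, ← smul_add, hDR]
    simp
  have hsum' : ∀ i j, (∑ l, b i l • D l) * N j + N j * (∑ l, b i l • D l) = b i j • 1 := by
    intro i j
    simp only [Finset.sum_mul, Finset.mul_sum, smul_mul_assoc, mul_smul_comm,
      ← Finset.sum_add_distrib, ← smul_add, hDN]
    simp
  have hNN : ∀ i j, N i * N j + N j * N i = 0 := by
    intro i j
    have e1 : N i * N j + N j * N i = (R i * N j + N j * R i) - (2⁻¹ : k) •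
        ((∑ l, b i l • D l) * N j + N j * (∑ l, b i l • D l)) := by
      conv_lhs => rw [show N i = R i - (2⁻¹ : k) • ∑ l, b i l • D l from rfl]
      simp only [mul_sub, sub_mul, smul_mul_assoc, mul_smul_comm, smul_add]
      abel
    have e2 : R i * N j + N j * R i = (R i * R j + R j * R i) - (2⁻¹ : k) •
        ((∑ l, b j l • D l) * R i + R i * (∑ l, b j l • D l)) := by
      rw [show N j = R j - (2⁻¹ : k) • ∑ l, b j l • D l from rfl]
      simp only [mul_sub, sub_mul, smul_mul_assoc, mul_smul_comm, smul_add]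
      abel
    have e3 : b j i • (1 : Module.End k V) = b i j • 1 := by rw [← hR, ← hR, add_comm]
    rw [e1, e2, hR, hsum, hsum', e3, sub_sub, ← smul_add, ← two_smul k, smul_smul,
      inv_mul_cancel₀ h2, one_smul, sub_self]
  have h𝒜D : ∀ i, D i ∈ 𝒜 := fun i => 𝒜.sum_mem fun l _ => 𝒜.smul_mem (h𝒜C l) _
  refine subalgebra_eq_top_of_car N D (fun i => hsq _ (hNN i i)) hNN (fun i => hsq _ (hDD i i)) hDD
    hDN Ω (fun i => by simp [D, hΩ]) ?_ 𝒜 ?_ h𝒜D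
  · intro W hW hN hD
    refine cyc W hW fun i x hx => ?_
    have : R i x = N i x + (2⁻¹ : k) • ∑ l, b i l • D l x := by simp [N]
    rw [this]
    exact W.add_mem (hN i x hx) (W.smul_mem _ (W.sum_mem fun l _ => W.smul_mem _ (hD l x hx)))
  · exact fun i => 𝒜.sub_mem (h𝒜R i)
      (𝒜.smul_mem (𝒜.sum_mem fun l _ => 𝒜.smul_mem (h𝒜D l) _) _)

end Fock

/-! ### Operators built recursively from skew derivations, and when they span -/

section Twisted

variable {k : Type*} [Field k] {B : Type*} [Ring B] [Algebra k B] {ι : Type*}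

/-- A subspace containing `1` and stable under left multiplication by generators is everything. -/
theorem mem_of_adjoin_left {w : ι → B} (gen : Algebra.adjoin k (Set.range w) = ⊤)
    (W : Submodule k B) (h1 : 1 ∈ W) (hw : ∀ i, ∀ x ∈ W, w i * x ∈ W) (x : B) : x ∈ W := by
  have key : ∀ b : B, ∀ y ∈ W, b * y ∈ W := by
    intro b
    have hb : b ∈ Algebra.adjoin k (Set.range w) := gen ▸ Algebra.mem_top
    induction hb using Algebra.adjoin_induction with
    | mem g hg => obtain ⟨i, rfl⟩ := hg; exact hw i
    | algebraMap a => intro y hy; rw [← Algebra.smul_def]; exact W.smul_mem _ hy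
    | add p q _ _ hp hq => intro y hy; rw [add_mul]; exact W.add_mem (hp y hy) (hq y hy)
    | mul p q _ _ hp hq => intro y hy; rw [mul_assoc]; exact hp _ (hq y hy)
  simpa using key x 1 h1

/-- A subspace containing `1` and stable under right multiplication by generators is everything. -/
theorem mem_of_adjoin_right {w : ι → B} (gen : Algebra.adjoin k (Set.range w) = ⊤)
    (W : Submodule k B) (h1 : 1 ∈ W) (hw : ∀ i, ∀ x ∈ W, x * w i ∈ W) (x : B) : x ∈ W := by
  have key : ∀ b : B, ∀ y ∈ W, y * b ∈ W := by
    intro b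
    have hb : b ∈ Algebra.adjoin k (Set.range w) := gen ▸ Algebra.mem_top
    induction hb using Algebra.adjoin_induction with
    | mem g hg => obtain ⟨i, rfl⟩ := hg; exact hw i
    | algebraMap a =>
      intro y hy; rw [← Algebra.commutes, ← Algebra.smul_def]; exact W.smul_mem _ hy
    | add p q _ _ hp hq => intro y hy; rw [mul_add]; exact W.add_mem (hp y hy) (hq y hy)
    | mul p q _ _ hp hq => intro y hy; rw [← mul_assoc]; exact hq _ (hp y hy)
  simpa using key x 1 h1

/-- Two linear maps agree if they agree at `1` and their agreement is preserved by left
multiplication by generators. -/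
theorem linearMap_eq_of_adjoin {w : ι → B} (gen : Algebra.adjoin k (Set.range w) = ⊤)
    {N : Type*} [AddCommGroup N] [Module k N] (f g : B →ₗ[k] N) (h1 : f 1 = g 1)
    (hw : ∀ i x, f x = g x → f (w i * x) = g (w i * x)) (x : B) : f x = g x :=
  mem_of_adjoin_left gen (LinearMap.eqLocus f g) h1 hw x

/-- An algebra generated by elements `w i` with scalar anticommutators `b i j`, with its grading
involution `σ`, skew derivations `D j` with `D j (w i) = a i j`, and a family of operators `Φ x`
built from these by the recursion `Φ (w i * x) = Φ x ∘ D i + w i * Φ x ∘ σ`. -/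
structure TwistedAction (w : ι → B) (b a : Matrix ι ι k) (σ : B →ₐ[k] B)
    (D : ι → Module.End k B) (Φ : B →ₗ[k] Module.End k B) : Prop where
  gen : Algebra.adjoin k (Set.range w) = ⊤
  w_mul : ∀ i j, w i * w j + w j * w i = algebraMap k B (b i j)
  σ_w : ∀ i, σ (w i) = - w i
  D_w : ∀ i j, D j (w i) = algebraMap k B (a i j)
  D_mul : ∀ j x y, D j (x * y) = x * D j y + D j x * σ y
  Φ_one : Φ 1 = 1
  Φ_mul : ∀ i x d, Φ (w i * x) d = Φ x (D i d) + w i * Φ x (σ d)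

namespace TwistedAction

variable {w : ι → B} {b a : Matrix ι ι k} {σ : B →ₐ[k] B} {D : ι → Module.End k B}
  {Φ : B →ₗ[k] Module.End k B}

theorem D_one (h : TwistedAction w b a σ D Φ) (j : ι) : D j 1 = 0 := by
  simpa using h.D_mul j 1 1

theorem D_w_mul (h : TwistedAction w b a σ D Φ) (i j : ι) (x : B) :
    D j (w i * x) = w i * D j x + a i j • σ x := by
  rw [h.D_mul, h.D_w, Algebra.smul_def]

theorem D_mul_w (h : TwistedAction w b a σ D Φ) (i j : ι) (x : B) :
    D j (x * w i) = a i j • x - D j x * w i := by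
  rw [h.D_mul, h.D_w, h.σ_w, mul_neg, ← Algebra.commutes, Algebra.smul_def, sub_eq_add_neg]

theorem σ_σ (h : TwistedAction w b a σ D Φ) (x : B) : σ (σ x) = x :=
  linearMap_eq_of_adjoin h.gen (σ.toLinearMap ∘ₗ σ.toLinearMap) LinearMap.id (by simp)
    (fun i x hx => by simpa [h.σ_w] using congrArg (w i * ·) hx) x

theorem σ_D (h : TwistedAction w b a σ D Φ) (j : ι) (x : B) : σ (D j x) = - D j (σ x) :=
  linearMap_eq_of_adjoin h.gen (σ.toLinearMap ∘ₗ D j) (-(D j ∘ₗ σ.toLinearMap)) (by simp [h.D_one])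
    (fun i x hx => by
      have hx' : σ (D j x) = - D j (σ x) := hx
      simp [h.D_w_mul, h.σ_w, h.σ_σ, hx', add_comm]) x

theorem D_D (h : TwistedAction w b a σ D Φ) (i j : ι) (x : B) : D i (D j x) = - D j (D i x) :=
  linearMap_eq_of_adjoin h.gen (D i ∘ₗ D j) (-(D j ∘ₗ D i)) (by simp [h.D_one])
    (fun l x hx => by
      have hx' : D i (D j x) = - D j (D i x) := hx
      simp [h.D_w_mul, h.σ_D, hx']
      abel) x

theorem Φ_w (h : TwistedAction w b a σ D Φ) (i : ι) (d : B) : Φ (w i) d = D i d + w i * σ d := by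
  simpa [h.Φ_one] using h.Φ_mul i 1 d

theorem σ_Φ (h : TwistedAction w b a σ D Φ) (x d : B) : σ (Φ x d) = Φ (σ x) (σ d) := by
  have := linearMap_eq_of_adjoin h.gen ((LinearMap.compRight k σ.toLinearMap) ∘ₗ Φ)
    (LinearMap.lcomp k B σ.toLinearMap ∘ₗ Φ ∘ₗ σ.toLinearMap)
    (by ext d; simp [h.Φ_one])
    (fun i x hx => by
      ext d
      have hx' : ∀ d, σ (Φ x d) = Φ (σ x) (σ d) := fun d => LinearMap.congr_fun hx d
      simp [h.Φ_mul, h.σ_w, hx', h.σ_D, add_comm]) x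
  exact LinearMap.congr_fun this d

/-- A Leibniz rule for the action, by induction on x through the recursion; the signs match because
D_j anticommutes with both D_i and σ. It is what makes products of the Φ computable. -/
theorem D_Φ (h : TwistedAction w b a σ D Φ) (j : ι) (x d : B) :
    D j (Φ x d) = Φ (σ x) (D j d) + Φ (D j x) d := by
  have := linearMap_eq_of_adjoin h.gen ((LinearMap.compRight k (D j)) ∘ₗ Φ)
    (LinearMap.lcomp k B (D j) ∘ₗ Φ ∘ₗ σ.toLinearMap + Φ ∘ₗ D j)
    (by ext d; simp [h.Φ_one, h.D_one])
    (fun i x hx => by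
      ext d
      have hx' : ∀ d, D j (Φ x d) = Φ (σ x) (D j d) + Φ (D j x) d :=
        fun d => LinearMap.congr_fun hx d
      simp only [LinearMap.comp_apply, LinearMap.compRight_apply, LinearMap.add_apply,
        LinearMap.lcomp_apply, AlgHom.toLinearMap_apply, map_mul, h.σ_w, neg_mul, map_neg,
        LinearMap.neg_apply, h.D_w_mul, map_add, map_smul, LinearMap.smul_apply,
        h.Φ_mul, hx', h.σ_D, h.D_D i j, h.σ_Φ, h.σ_σ, mul_add, mul_neg]
      abel) x
  exact LinearMap.congr_fun this d

/-- Composing with Φ_{w_j} on the left stays within the operators Φ_y. -/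
theorem Φ_w_Φ (h : TwistedAction w b a σ D Φ) (j : ι) (x d : B) :
    Φ (w j) (Φ x d) = Φ (w j * σ x) d + Φ (D j x) d := by
  rw [h.Φ_w, h.D_Φ, h.σ_Φ, h.Φ_mul]
  abel

/-- Moves Φ_{w_j} past a right multiplication. With `Φ_w_Φ` it makes the span of the R_x Φ_y stable
under left composition with Φ_{w_j}. -/
theorem Φ_w_mulRight (h : TwistedAction w b a σ D Φ) (j : ι) (x d : B) :
    Φ (w j) (d * x) = d * D j x + Φ (w j) d * σ x := by
  simp only [h.Φ_w, h.D_mul, map_mul, add_mul, mul_assoc]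
  abel

variable [Fintype ι] [DecidableEq ι]

/-- The operators `d ↦ Φ y d * x` span the endomorphism algebra if `b - aᵀ` is invertible. -/
theorem span_eq_top [Module.Finite k B] (h : TwistedAction w b a σ D Φ) (h2 : (2 : k) ≠ 0)
    (hM : (b - a.transpose).det ≠ 0) :
    Submodule.span k (Set.range fun p : B × B => LinearMap.mulRight k p.1 * Φ p.2) = ⊤ := by
  set I := Submodule.span k (Set.range fun p : B × B => LinearMap.mulRight k p.1 * Φ p.2)
  have hmem : ∀ x y, LinearMap.mulRight k x * Φ y ∈ I :=
    fun x y => Submodule.subset_span ⟨(x, y), rfl⟩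
  let R : ι → Module.End k B := fun i => LinearMap.mulRight k (w i)
  -- C_i(d) = d w_i - w_i σ(d) - D_i d, a twisted commutator that vanishes at d = 1.
  let C : ι → Module.End k B := fun i => R i - Φ (w i)
  let 𝒜 : Subalgebra k (Module.End k B) := Algebra.adjoin k (Set.range R ∪ Set.range C)
  have h𝒜R : ∀ i, R i ∈ 𝒜 := fun i => Algebra.subset_adjoin (Or.inl ⟨i, rfl⟩)
  have h𝒜C : ∀ i, C i ∈ 𝒜 := fun i => Algebra.subset_adjoin (Or.inr ⟨i, rfl⟩)
  have hRI : ∀ i, ∀ T ∈ I, R i * T ∈ I := by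
    intro i T hT
    induction hT using Submodule.span_induction with
    | mem T hT =>
      obtain ⟨⟨x, y⟩, rfl⟩ := hT
      have : R i * (LinearMap.mulRight k x * Φ y) = LinearMap.mulRight k (x * w i) * Φ y := by
        ext d
        simp [R, mul_assoc]
      rw [this]
      exact hmem _ _
    | zero => simp
    | add S T _ _ hS hT => rw [mul_add]; exact I.add_mem hS hT
    | smul a T _ hT => rw [mul_smul_comm]; exact I.smul_mem _ hT
  have hΦI : ∀ i, ∀ T ∈ I, Φ (w i) * T ∈ I := by
    intro i T hT
    induction hT using Submodule.span_induction with
    | mem T hT =>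
      obtain ⟨⟨x, y⟩, rfl⟩ := hT
      have : Φ (w i) * (LinearMap.mulRight k x * Φ y) = LinearMap.mulRight k (D i x) * Φ y +
          LinearMap.mulRight k (σ x) * Φ (w i * σ y + D i y) := by
        ext d
        simp [h.Φ_w_mulRight, h.Φ_w_Φ]
      rw [this]
      exact I.add_mem (hmem _ _) (hmem _ _)
    | zero => simp
    | add S T _ _ hS hT => rw [mul_add]; exact I.add_mem hS hT
    | smul a T _ hT => rw [mul_smul_comm]; exact I.smul_mem _ hT
  -- The span I contains 1 and is stable under 𝒜, so it contains 𝒜; it suffices that 𝒜 is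
  -- everything.
  have h𝒜I : ∀ T ∈ 𝒜, ∀ S ∈ I, T * S ∈ I := by
    intro T hT
    induction hT using Algebra.adjoin_induction with
    | mem T hT =>
      intro S hS
      rcases hT with ⟨i, rfl⟩ | ⟨i, rfl⟩
      · exact hRI i S hS
      · simp only [C, sub_mul]
        exact I.sub_mem (hRI i S hS) (hΦI i S hS)
    | algebraMap a => intro S hS; rw [← Algebra.smul_def]; exact I.smul_mem _ hS
    | add p q _ _ hp hq => intro S hS; rw [add_mul]; exact I.add_mem (hp S hS) (hq S hS)
    | mul p q _ _ hp hq => intro S hS; rw [mul_assoc]; exact hp _ (hq S hS)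
  have hone : (1 : Module.End k B) ∈ I := by
    have := hmem 1 1
    rwa [h.Φ_one, mul_one, LinearMap.mulRight_one] at this
  have htop : 𝒜 = ⊤ := by
    refine subalgebra_eq_top_of_clifford h2 R C b (b - a.transpose) hM ?_ ?_ ?_ 1 ?_ ?_ 𝒜 h𝒜R h𝒜C
    · intro i j
      ext d
      simp only [R, LinearMap.add_apply, Module.End.mul_apply, LinearMap.mulRight_apply,
        LinearMap.smul_apply, Module.End.one_apply]
      rw [mul_assoc, mul_assoc, ← mul_add, add_comm, h.w_mul, ← Algebra.commutes,
        Algebra.smul_def]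
    -- The scalars b_ij produced by right multiplications cancel those produced by left
    -- multiplications; the mixed terms cancel in pairs.
    · intro i j
      ext d
      have h1 : d * w j * w i = b i j • d - d * w i * w j := by
        rw [eq_sub_iff_add_eq, mul_assoc, mul_assoc, ← mul_add, add_comm, h.w_mul,
          ← Algebra.commutes, Algebra.smul_def]
      have h2 : w j * (w i * d) = b i j • d - w i * (w j * d) := by
        rw [eq_sub_iff_add_eq, ← mul_assoc, ← mul_assoc, ← add_mul, add_comm, h.w_mul,
          Algebra.smul_def]
      simp only [C, R, LinearMap.add_apply, Module.End.mul_apply, LinearMap.sub_apply,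
        LinearMap.mulRight_apply, h.Φ_w, map_add, map_mul, h.D_w_mul, h.D_mul_w, h.σ_w,
        h.σ_σ, h.σ_D, sub_mul, mul_sub, mul_add, mul_neg, neg_mul, h.D_D j i, h1, h2,
        LinearMap.zero_apply, mul_assoc]
      abel
    -- Two right multiplications contribute b_ij, and D_i applied to w_j contributes -a_ji; this is
    -- why the transpose of a appears.
    · intro i j
      ext d
      have h1 : d * w j * w i = b i j • d - d * w i * w j := by
        rw [eq_sub_iff_add_eq, mul_assoc, mul_assoc, ← mul_add, add_comm, h.w_mul,
          ← Algebra.commutes, Algebra.smul_def]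
      simp only [C, R, LinearMap.add_apply, Module.End.mul_apply, LinearMap.sub_apply,
        LinearMap.mulRight_apply, h.Φ_w, map_mul, h.D_mul_w, h.σ_w, sub_mul, add_mul,
        mul_neg, h1, LinearMap.smul_apply, Module.End.one_apply, Matrix.sub_apply,
        Matrix.transpose_apply, sub_smul, mul_assoc]
      abel
    · intro i
      simp [C, R, h.Φ_w, h.D_one]
    · intro W h1 hW
      exact (Submodule.eq_top_iff'.2 (mem_of_adjoin_right h.gen W h1 hW))
  rw [eq_top_iff]
  intro T _
  simpa using h𝒜I T (htop ▸ Algebra.mem_top) 1 hone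

/-- If the operators `d ↦ Φ y d * x` span the endomorphism algebra, then `b - aᵀ` is invertible. -/
theorem det_ne_zero_of_span_eq_top (h : TwistedAction w b a σ D Φ)
    (ind : ∀ (s : k) (t : ι → k), ∑ i, t i • w i = algebraMap k B s → t = 0)
    (hspan : Submodule.span k
      (Set.range fun p : B × B => LinearMap.mulRight k p.1 * Φ p.2) = ⊤) :
    (b - a.transpose).det ≠ 0 := by
  intro hdet
  obtain ⟨t, ht, hMt⟩ := Matrix.exists_mulVec_eq_zero_iff.2 hdet
  apply ht
  set z := ∑ i, t i • w i with hz
  have hσz : σ z = - z := by simp [hz, h.σ_w]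
  -- That t lies in the kernel of b - aᵀ says exactly that the anticommutator of w_i with z equals
  -- D_i z.
  have hg : ∀ i, w i * z + z * w i = algebraMap k B (∑ j, a j i * t j) := by
    intro i
    have h1 : w i * z + z * w i = algebraMap k B (∑ j, b i j * t j) := by
      simp only [hz, Finset.mul_sum, Finset.sum_mul, ← Finset.sum_add_distrib, mul_smul_comm,
        smul_mul_assoc, ← smul_add, h.w_mul, map_sum, map_mul]
      refine Finset.sum_congr rfl fun j _ => ?_
      rw [Algebra.smul_def, ← map_mul, ← map_mul, mul_comm]
    have h2 := congrFun hMt i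
    simp only [Matrix.mulVec, dotProduct, Matrix.sub_apply, Matrix.transpose_apply, sub_mul,
      Finset.sum_sub_distrib, Pi.zero_apply, sub_eq_zero] at h2
    rw [h1, h2]
  have hDz : ∀ i x, D i (z * x) = z * D i x + (∑ j, a j i * t j) • σ x := by
    intro i x
    rw [h.D_mul, hz, map_sum]
    simp only [map_smul, h.D_w]
    rw [Algebra.smul_def, map_sum]
    congr 2
    exact Finset.sum_congr rfl fun j _ => by rw [Algebra.smul_def, ← map_mul, mul_comm]
  -- In the recursion for Φ_{w_i x}(z d), the scalar from D_i z cancels the one from moving z past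
  -- w_i.
  have hΦz : ∀ x, Φ x * LinearMap.mulLeft k z = LinearMap.mulLeft k z * Φ x :=
    linearMap_eq_of_adjoin h.gen (LinearMap.mulRight k (LinearMap.mulLeft k z) ∘ₗ Φ)
      (LinearMap.mulLeft k (LinearMap.mulLeft k z) ∘ₗ Φ) (by simp [h.Φ_one])
      (fun i x hx => by
        have hx' : ∀ d, Φ x (z * d) = z * Φ x d := fun d => LinearMap.congr_fun hx d
        ext d
        have hc : z * (w i * Φ x (σ d)) =
            (∑ j, a j i * t j) • Φ x (σ d) - w i * (z * Φ x (σ d)) := by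
          rw [eq_sub_iff_add_eq', ← mul_assoc, ← mul_assoc, ← add_mul, hg, Algebra.smul_def]
        simp only [LinearMap.comp_apply, LinearMap.mulRight_apply, LinearMap.mulLeft_apply,
          Module.End.mul_apply, h.Φ_mul, hDz, map_add, hx', map_mul, hσz, neg_mul, map_neg,
          map_smul, mul_neg, hc]
        abel)
  have hcomm : ∀ (T : Module.End k B) (d : B), T (z * d) = z * T d := by
    intro T
    have hT : T ∈ Submodule.span k
        (Set.range fun p : B × B => LinearMap.mulRight k p.1 * Φ p.2) := hspan ▸ Submodule.mem_top
    induction hT using Submodule.span_induction with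
    | mem T hT =>
      obtain ⟨⟨x, y⟩, rfl⟩ := hT
      intro d
      have : Φ y (z * d) = z * Φ y d := LinearMap.congr_fun (hΦz y) d
      simp [this, mul_assoc]
    | zero => simp
    | add S T _ _ hS hT => intro d; simp [hS, hT, mul_add]
    | smul a T _ hT => intro d; simp [hT]
  by_contra ht0
  have hzs : ∀ s : k, z ≠ algebraMap k B s := fun s hs => ht0 (ind s t hs)
  have hnot : z ∉ Submodule.span k {(1 : B)} := by
    intro hmem
    obtain ⟨s, hs⟩ := Submodule.mem_span_singleton.1 hmem
    exact hzs s (by rw [← hs, Algebra.algebraMap_eq_smul_one])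
  -- With f(1) = 0 and f(z) ≠ 0, the rank-one operator d ↦ f(d)·1 cannot commute with left
  -- multiplication by z.
  obtain ⟨f, hf, hf'⟩ := Submodule.exists_dual_map_eq_bot_of_notMem hnot inferInstance
  have hf1 : f 1 = 0 := by
    have : f 1 ∈ Submodule.map f (Submodule.span k {(1 : B)}) :=
      ⟨1, Submodule.mem_span_singleton_self 1, rfl⟩
    simpa [hf'] using this
  have := hcomm (f.smulRight 1) 1
  simp only [mul_one, LinearMap.smulRight_apply, hf1, zero_smul, mul_zero] at this
  rcases smul_eq_zero.1 this with h0 | h0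
  · exact hf h0
  · exact hzs 0 (by rw [← mul_one z, h0]; simp)

end TwistedAction

end Twisted

/-! ### Skew derivations as entries of triangular matrices -/

section SkewDerivation

variable {k : Type*} [Field k] {B : Type*} [Ring B] [Algebra k B]

/-- If an algebra map to `2 × 2` matrices has diagonal entries `x` and `σ x` and is upper triangular
on generators, then its upper right entry is a skew derivation. -/
theorem skew_mul_of_matrix (s : Set B) (gen : Algebra.adjoin k s = ⊤) (σ : B →ₐ[k] B)
    (φ : B →ₐ[k] Matrix (Fin 2) (Fin 2) B)
    (h : ∀ x ∈ s, φ x 0 0 = x ∧ φ x 1 0 = 0 ∧ φ x 1 1 = σ x) (x y : B) :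
    φ (x * y) 0 1 = x * φ y 0 1 + φ x 0 1 * σ y := by
  have key : ∀ x, φ x 0 0 = x ∧ φ x 1 0 = 0 ∧ φ x 1 1 = σ x := by
    intro x
    have hx : x ∈ Algebra.adjoin k s := gen ▸ Algebra.mem_top
    induction hx using Algebra.adjoin_induction with
    | mem x hx => exact h x hx
    | algebraMap r => simp [Matrix.algebraMap_matrix_apply]
    | add x y _ _ hx hy => simp [hx, hy]
    | mul x y _ _ hx hy => simp [Matrix.mul_apply, Fin.sum_univ_two, hx, hy]
  simp [Matrix.mul_apply, Fin.sum_univ_two, key]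

/-- The upper right entry of an algebra map to `2 × 2` matrices. -/
def upperRight (φ : B →ₐ[k] Matrix (Fin 2) (Fin 2) B) : B →ₗ[k] B :=
  Matrix.entryLinearMap k B 0 1 ∘ₗ φ.toLinearMap

theorem upperRight_apply (φ : B →ₐ[k] Matrix (Fin 2) (Fin 2) B) (x : B) :
    upperRight φ x = φ x 0 1 := rfl

end SkewDerivation

/-! ### Skew derivations of E(n) and the r-form on words -/

namespace E

universe u

variable {k : Type u} [Field k] {n : ℕ}

/-- The involution `c ↦ -c`, `x_i ↦ -x_i` of `E(n)`. -/
def inv : E k n →ₐ[k] E k n :=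
  lift (-c k n) (fun i => -x k i) (by simp [c_mul_c]) (by simp [c_x]) (by simp [x_x])
    (by simp [x_mul_x])

@[simp]
theorem inv_c : inv (c k n) = - c k n := lift_c ..

@[simp]
theorem inv_x (i : Fin n) : inv (x k i) = - x k i := lift_x ..

/-- The algebra map `c ↦ diag(c, -c)`, `x_i ↦ (x_i, f i; 0, -x_i)`. -/
def skewMatrix (f : Fin n → k) : E k n →ₐ[k] Matrix (Fin 2) (Fin 2) (E k n) :=
  lift !![c k n, 0; 0, -c k n] (fun i => !![x k i, algebraMap k _ (f i); 0, -x k i])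
    (by simp [c_mul_c, Matrix.one_fin_two])
    (fun i => by
      ext a b
      fin_cases a <;> fin_cases b <;> simp [Algebra.algebraMap_eq_smul_one, c_x])
    (fun i j => by
      ext a b
      fin_cases a <;> fin_cases b <;> simp [Algebra.algebraMap_eq_smul_one, x_x])
    (fun i => by
      ext a b
      fin_cases a <;> fin_cases b <;> simp [Algebra.algebraMap_eq_smul_one, x_mul_x])

/-- The skew derivation of `E(n)` with `c ↦ 0` and `x_i ↦ f i`. -/
def skew (f : Fin n → k) : E k n →ₗ[k] E k n := upperRight (skewMatrix f)

@[simp]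
theorem skew_c (f : Fin n → k) : skew f (c k n) = 0 := by
  simp [skew, upperRight_apply, skewMatrix]

@[simp]
theorem skew_x (f : Fin n → k) (i : Fin n) : skew f (x k i) = algebraMap k _ (f i) := by
  simp [skew, upperRight_apply, skewMatrix]

theorem skew_mul (f : Fin n → k) (a b : E k n) :
    skew f (a * b) = a * skew f b + skew f a * inv b := by
  refine skew_mul_of_matrix _ (adjoin_eq_top k n) inv (skewMatrix f) ?_ a b
  rintro _ (rfl | ⟨i, rfl⟩) <;> simp [skewMatrix]

@[simp]
theorem skew_one (f : Fin n → k) : skew f (1 : E k n) = 0 := by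
  simpa using skew_mul f 1 1

theorem skew_c_mul (f : Fin n → k) (a : E k n) : skew f (c k n * a) = c k n * skew f a := by
  simp [skew_mul]

theorem skew_x_mul (f : Fin n → k) (i : Fin n) (a : E k n) :
    skew f (x k i * a) = x k i * skew f a + f i • inv a := by
  simp [skew_mul, Algebra.smul_def]

/-- The generators of `E(n)` as one family. -/
def gens (k : Type u) [Field k] (n : ℕ) : Unit ⊕ Fin n → E k n := Sum.elim (fun _ => c k n) (x k)

theorem adjoin_gens : Algebra.adjoin k (Set.range (gens k n)) = ⊤ := by
  rw [← adjoin_eq_top k n, gens, Set.Sum.elim_range, Set.range_const, Set.singleton_union]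

theorem inv_inv (a : E k n) : inv (inv a) = a :=
  linearMap_eq_of_adjoin adjoin_gens (inv.toLinearMap ∘ₗ inv.toLinearMap) LinearMap.id (by simp)
    (fun i x hx => by
      have hx' : inv (inv x) = x := hx
      rcases i with i | i <;> simp [gens, hx']) a

theorem inv_skew (f : Fin n → k) (a : E k n) : inv (skew f a) = - skew f (inv a) :=
  linearMap_eq_of_adjoin adjoin_gens (inv.toLinearMap ∘ₗ skew f) (-(skew f ∘ₗ inv.toLinearMap))
    (by simp)
    (fun i x hx => by
      have hx' : inv (skew f x) = - skew f (inv x) := hx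
      rcases i with i | i <;> simp [gens, skew_c_mul, skew_x_mul, inv_inv, hx', add_comm]) a

theorem skew_skew (f g : Fin n → k) (a : E k n) : skew f (skew g a) = - skew g (skew f a) :=
  linearMap_eq_of_adjoin adjoin_gens (skew f ∘ₗ skew g) (-(skew g ∘ₗ skew f)) (by simp)
    (fun i x hx => by
      have hx' : skew f (skew g x) = - skew g (skew f x) := hx
      rcases i with i | i
      · simp [gens, skew_c_mul, hx']
      · simp [gens, skew_x_mul, inv_skew, hx']
        abel) a

theorem skew_sq (f : Fin n → k) (a : E k n) : skew f (skew f a) = 0 :=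
  linearMap_eq_of_adjoin adjoin_gens (skew f ∘ₗ skew f) 0 (by simp)
    (fun i x hx => by
      have hx' : skew f (skew f x) = 0 := hx
      rcases i with i | i <;> simp [gens, skew_c_mul, skew_x_mul, inv_skew, hx']) a

/-! ### Values of the `r`-form -/

theorem basis_induction {N : Type*} [AddCommGroup N] [Module k N] (f g : E k n →ₗ[k] N)
    (h : ∀ (a : Fin 2) (P : Finset (Fin n)), f (c k n ^ (a : ℕ) * ordProd (x k) P) =
      g (c k n ^ (a : ℕ) * ordProd (x k) P)) : f = g :=
  (basis k n).ext fun ⟨a, P⟩ => by simpa using h a P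

/-- The four terms of r_A differ only by a sign: a c in the second argument contributes the parity
of |P| + a, the number of generators in the first argument. -/
theorem rForm_basis (A : Matrix (Fin n) (Fin n) k) (a b : Fin 2) (P F : Finset (Fin n)) :
    rForm A ((c k n ^ (a : ℕ) * ordProd (x k) P) ⊗ₜ (c k n ^ (b : ℕ) * ordProd (x k) F)) =
      (-1) ^ (P.card * (P.card - 1) / 2) * minorSum A P F *
        (-1) ^ ((b : ℕ) * (P.card + (a : ℕ))) := by
  have hd : ∀ (a b : Fin 2) (P Q : Finset (Fin n)), (basis k n).coord (a, P)
      (c k n ^ (b : ℕ) * ordProd (x k) Q) = if a = b ∧ P = Q then 1 else 0 := by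
    intro a b P Q
    rw [← basis_apply, Module.Basis.coord_apply, Module.Basis.repr_self, Finsupp.single_apply]
    simp [Prod.ext_iff, eq_comm]
  rw [rForm, map_sum, LinearMap.sum_apply, Finset.sum_eq_single P, map_smul, map_sum,
    LinearMap.smul_apply, LinearMap.sum_apply, Finset.sum_eq_single F]
  · have h01 : ∀ a : Fin 2, a = 0 ∨ a = 1 := by decide
    simp only [map_smul, map_add, map_sub, LinearMap.add_apply, LinearMap.sub_apply,
      LinearMap.smul_apply, xDual, cxDual, TensorProduct.dualDistrib_apply, hd, and_true]
    rcases h01 a with rfl | rfl <;> rcases h01 b with rfl | rfl <;>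
      simp [pow_succ, mul_assoc]
  · intro F' _ hF
    simp [xDual, cxDual, TensorProduct.dualDistrib_apply, hd, hF]
  · simp
  · intro P' _ hP
    simp [xDual, cxDual, TensorProduct.dualDistrib_apply, hd, hP]
  · simp

theorem inv_ordProd (P : Finset (Fin n)) :
    inv (ordProd (x k) P) = (-1 : k) ^ P.card • ordProd (x k) P := by
  induction P using Finset.induction_on_min with
  | empty => simp [ordProd]
  | insert i P hP ih =>
    rw [ordProd_insert _ hP, map_mul, ih,
      Finset.card_insert_of_notMem fun h => lt_irrefl _ (hP i h)]
    simp [pow_succ]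

/-- The sign caused by c in `rForm_basis` is the eigenvalue of `inv` on c^a x_P. -/
theorem rForm_c_mul_right (A : Matrix (Fin n) (Fin n) k) (d h : E k n) :
    rForm A (d ⊗ₜ (c k n * h)) = rForm A (inv d ⊗ₜ h) := by
  have h01 : ∀ a : Fin 2, a = 0 ∨ a = 1 := by decide
  have key : (TensorProduct.curry (rForm A)).compl₂ (LinearMap.mulLeft k (c k n)) =
      (TensorProduct.curry (rForm A)) ∘ₗ inv.toLinearMap := by
    refine basis_induction _ _ fun a P => basis_induction _ _ fun b F => ?_
    have hi : inv (c k n ^ (a : ℕ) * ordProd (x k) P) =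
        (-1 : k) ^ (P.card + (a : ℕ)) • (c k n ^ (a : ℕ) * ordProd (x k) P) := by
      rw [map_mul, inv_ordProd]
      rcases h01 a with rfl | rfl <;> simp [pow_succ]
    simp only [LinearMap.compl₂_apply, LinearMap.comp_apply, TensorProduct.curry_apply,
      LinearMap.mulLeft_apply, AlgHom.toLinearMap_apply, hi, map_smul,
      LinearMap.smul_apply]
    rcases h01 b with rfl | rfl
    · have := rForm_basis A a 1 P F
      simp only [Fin.val_one, pow_one, one_mul] at this
      rw [rForm_basis]
      simp only [Fin.val_zero, pow_zero, one_mul, this, zero_mul, mul_one, smul_eq_mul]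
      ring
    · have := rForm_basis A a 0 P F
      simp only [Fin.val_zero, pow_zero, one_mul, zero_mul, mul_one] at this
      rw [rForm_basis]
      simp only [Fin.val_one, pow_one, one_mul, ← mul_assoc, c_mul_c, this, smul_eq_mul]
      have hs : (-1 : k) ^ (P.card + (a : ℕ)) * (-1) ^ (P.card + (a : ℕ)) = 1 := by
        rw [← mul_pow, neg_one_mul, neg_neg, one_pow]
      linear_combination (-((-1) ^ (P.card * (P.card - 1) / 2) * minorSum A P F)) * hs
  exact LinearMap.congr_fun (LinearMap.congr_fun key d) h

/-- A c in the first argument is visible only if the second argument also contains c, hence the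
restriction to words x_F. -/
theorem rForm_c_mul_left (A : Matrix (Fin n) (Fin n) k) (d : E k n) (F : Finset (Fin n)) :
    rForm A ((c k n * d) ⊗ₜ ordProd (x k) F) = rForm A (d ⊗ₜ ordProd (x k) F) := by
  have h01 : ∀ a : Fin 2, a = 0 ∨ a = 1 := by decide
  have key : (TensorProduct.curry (rForm A)).flip (ordProd (x k) F) ∘ₗ
      (LinearMap.mulLeft k (c k n)) = (TensorProduct.curry (rForm A)).flip (ordProd (x k) F) := by
    refine basis_induction _ _ fun a P => ?_
    have h0 := rForm_basis A 0 0 P F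
    have h1 := rForm_basis A 1 0 P F
    simp only [Fin.val_zero, Fin.val_one, pow_zero, one_mul, zero_mul, pow_one] at h0 h1
    rcases h01 a with rfl | rfl
    · simp [h0, h1]
    · simp [h0, h1, ← mul_assoc, c_mul_c]
  exact LinearMap.congr_fun key d

/-- The word `x_{p 0} x_{p 1} ⋯`. -/
def word {s : ℕ} (p : Fin s → Fin n) : E k n := (List.ofFn fun i => x k (p i)).prod

theorem word_succ {s : ℕ} (p : Fin (s + 1) → Fin n) :
    word (k := k) p = x k (p 0) * word fun i => p i.succ := by
  simp [word, List.ofFn_succ]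

theorem ordProd_eq_word (P : Finset (Fin n)) {s : ℕ} (hs : P.card = s) :
    ordProd (x k) P = word (P.orderEmbOfFin hs) := by
  rw [ordProd, word, ← Finset.listMap_orderEmbOfFin_finRange P hs, List.map_map, List.ofFn_eq_map]
  rfl

theorem inv_word {s : ℕ} (p : Fin s → Fin n) : inv (word (k := k) p) = (-1 : k) ^ s • word p := by
  induction s with
  | zero => simp [word]
  | succ s ih => rw [word_succ, map_mul, ih]; simp [pow_succ]

/-- The sign counts the s - l letters to the right of the deleted letter, each negated by `inv`. -/
theorem skew_word (f : Fin n → k) {s : ℕ} (p : Fin (s + 1) → Fin n) :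
    skew f (word p) = ∑ l : Fin (s + 1), ((-1 : k) ^ (s + (l : ℕ)) * f (p l)) •
      word fun i => p (l.succAbove i) := by
  induction s with
  | zero => simp [word, Algebra.algebraMap_eq_smul_one]
  | succ s ih =>
    rw [word_succ, skew_x_mul, ih, inv_word, Finset.mul_sum, add_comm, Fin.sum_univ_succ (n := s +
      1)]
    congr 1
    · simp [smul_smul, mul_comm]
    · refine Finset.sum_congr rfl fun l _ => ?_
      rw [word_succ (fun i => p (l.succ.succAbove i)), mul_smul_comm]
      simp only [Fin.succ_succAbove_zero, Fin.succ_succAbove_succ, Fin.val_succ]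
      congr 2
      ring

/-- The permutation acts on the column index, so the Leibniz formula is applied to the transpose. -/
theorem minorSum_eq_det (A : Matrix (Fin n) (Fin n) k) (P F : Finset (Fin n)) {s : ℕ}
    (hP : P.card = s) (hF : F.card = s) :
    minorSum A P F = (A.submatrix (P.orderEmbOfFin hP) (F.orderEmbOfFin hF)).det := by
  subst hP
  rw [minorSum, dif_pos hF, ← Matrix.det_transpose, Matrix.det_apply']
  rfl

theorem minorSum_eq_zero (A : Matrix (Fin n) (Fin n) k) {P F : Finset (Fin n)}
    (h : F.card ≠ P.card) : minorSum A P F = 0 := dif_neg h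

theorem minorSum_transpose (A : Matrix (Fin n) (Fin n) k) (P F : Finset (Fin n)) :
    minorSum A.transpose F P = minorSum A P F := by
  by_cases h : F.card = P.card
  · rw [minorSum_eq_det A P F rfl h, minorSum_eq_det A.transpose F P h rfl, ← Matrix.det_transpose]
    rfl
  · rw [minorSum_eq_zero A h, minorSum_eq_zero _ (Ne.symm h)]

theorem exists_finset_word {s : ℕ} (p : Fin s → Fin n) (hp : StrictMono p) :
    ∃ P : Finset (Fin n), ∃ h : P.card = s, ⇑(P.orderEmbOfFin h) = p :=
  ⟨Finset.univ.image p, by rw [Finset.card_image_of_injective _ hp.injective, Finset.card_fin],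
    (Finset.orderEmbOfFin_unique _ (by simp) hp).symm⟩

theorem rForm_word (A : Matrix (Fin n) (Fin n) k) {s : ℕ} (p f : Fin s → Fin n)
    (hp : StrictMono p) (hf : StrictMono f) :
    rForm A (word p ⊗ₜ word f) = (-1) ^ (s * (s - 1) / 2) * (A.submatrix p f).det := by
  obtain ⟨P, hP, rfl⟩ := exists_finset_word p hp
  obtain ⟨F, hF, rfl⟩ := exists_finset_word f hf
  have := rForm_basis A 0 0 P F
  simp only [Fin.val_zero, pow_zero, one_mul, zero_mul, mul_one,
    minorSum_eq_det A P F hP hF] at this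
  rw [← ordProd_eq_word, ← ordProd_eq_word, this, hP]

theorem rForm_word_of_ne (A : Matrix (Fin n) (Fin n) k) {s t : ℕ} (p : Fin s → Fin n)
    (f : Fin t → Fin n) (hp : StrictMono p) (hf : StrictMono f) (hst : t ≠ s) :
    rForm A (word p ⊗ₜ word f) = 0 := by
  obtain ⟨P, hP, rfl⟩ := exists_finset_word p hp
  obtain ⟨F, hF, rfl⟩ := exists_finset_word f hf
  have := rForm_basis A 0 0 P F
  simp only [Fin.val_zero, pow_zero, one_mul, zero_mul, mul_one,
    minorSum_eq_zero A (P := P) (F := F) (by rwa [hP, hF]), mul_zero] at this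
  rw [← ordProd_eq_word, ← ordProd_eq_word, this]

theorem neg_one_pow_triangle (s : ℕ) :
    (-1 : k) ^ ((s + 1) * (s + 1 - 1) / 2) = (-1) ^ s * (-1) ^ (s * (s - 1) / 2) := by
  rw [← pow_add, Nat.triangle_succ, add_comm]

/-- Expansion of the `r`-form along a column. -/
theorem rForm_word_cons (A : Matrix (Fin n) (Fin n) k) {s t : ℕ} (p : Fin s → Fin n)
    (f : Fin (t + 1) → Fin n) (hp : StrictMono p) (hf : StrictMono f) :
    rForm A (word p ⊗ₜ word f) =
      rForm A (skew (fun i => A i (f 0)) (word p) ⊗ₜ word fun i : Fin t => f i.succ) := by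
  have hf' : StrictMono fun i : Fin t => f i.succ := hf.comp (Fin.strictMono_succ)
  cases s with
  | zero =>
    rw [rForm_word_of_ne A p f hp hf (Nat.succ_ne_zero t)]
    simp [word]
  | succ s =>
    have hp' : ∀ l : Fin (s + 1), StrictMono fun i => p (l.succAbove i) :=
      fun l => hp.comp (Fin.strictMono_succAbove l)
    rw [skew_word, TensorProduct.sum_tmul, map_sum]
    simp only [← TensorProduct.smul_tmul', map_smul]
    by_cases hst : t = s
    · subst hst
      -- The prefactors for sizes s + 1 and s differ by (-1)^s; with the cofactor sign (-1)^l this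
      -- is the sign of `skew_word`.
      rw [rForm_word A p f hp hf, Matrix.det_succ_column_zero, Finset.mul_sum]
      refine Finset.sum_congr rfl fun l _ => ?_
      rw [rForm_word A _ _ (hp' l) hf', neg_one_pow_triangle, pow_add, smul_eq_mul,
        Matrix.submatrix_submatrix, Matrix.submatrix_apply]
      simp only [Function.comp_def]
      ring
    · rw [rForm_word_of_ne A p f hp hf (by omega)]
      refine (Finset.sum_eq_zero fun l _ => ?_).symm
      rw [rForm_word_of_ne A _ _ (hp' l) hf' hst, smul_zero]

end E

/-! ### Multiplication rules and reversal symmetry of the r-form -/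

namespace E

universe u

variable {k : Type u} [Field k] {n : ℕ}

/-- Since j precedes F, the product x_j x_F is already an ordered word whose first column is j, and
the column expansion applies. -/
theorem rForm_x_mul_ordProd_of_lt (A : Matrix (Fin n) (Fin n) k) (j : Fin n) (F : Finset (Fin n))
    (hF : ∀ i ∈ F, j < i) (d : E k n) :
    rForm A (d ⊗ₜ (x k j * ordProd (x k) F)) =
      rForm A (skew (fun i => A i j) d ⊗ₜ ordProd (x k) F) := by
  have h01 : ∀ a : Fin 2, a = 0 ∨ a = 1 := by decide
  have h0 : ∀ P : Finset (Fin n), rForm A (ordProd (x k) P ⊗ₜ (x k j * ordProd (x k) F)) =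
      rForm A (skew (fun i => A i j) (ordProd (x k) P) ⊗ₜ ordProd (x k) F) := by
    intro P
    let f : Fin (F.card + 1) → Fin n := Fin.cons j (F.orderEmbOfFin rfl)
    have hf : StrictMono f := by
      intro a b hab
      induction b using Fin.cases with
      | zero => exact absurd hab (Fin.not_lt_zero a)
      | succ b =>
        induction a using Fin.cases with
        | zero => exact hF _ (Finset.orderEmbOfFin_mem _ _ _)
        | succ a => exact (F.orderEmbOfFin rfl).strictMono (Fin.succ_lt_succ_iff.1 hab)
    have h := rForm_word_cons A (P.orderEmbOfFin rfl) f (P.orderEmbOfFin rfl).strictMono hf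
    rw [word_succ] at h
    simpa [f, ← ordProd_eq_word] using h
  have key : (TensorProduct.curry (rForm A)).flip (x k j * ordProd (x k) F) =
      (TensorProduct.curry (rForm A)).flip (ordProd (x k) F) ∘ₗ skew (fun i => A i j) := by
    refine basis_induction _ _ fun a P => ?_
    rcases h01 a with rfl | rfl
    · simpa using h0 P
    · simp only [LinearMap.flip_apply, TensorProduct.curry_apply, LinearMap.comp_apply,
        Fin.val_one, pow_one, skew_c_mul, rForm_c_mul_left, ← h0]
      rw [← ordProd_insert _ hF, rForm_c_mul_left]
  exact LinearMap.congr_fun key d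

/-- Skew derivations obey the exterior relations of the x_j: they square to zero and anticommute. So
x_j can be moved past a smaller first letter x_l; then x_j x_F is a combination of words with all
letters above l, where the ordered case handles x_l. -/
theorem rForm_x_mul_ordProd (A : Matrix (Fin n) (Fin n) k) (j : Fin n) (F : Finset (Fin n))
    (d : E k n) :
    rForm A (d ⊗ₜ (x k j * ordProd (x k) F)) =
      rForm A (skew (fun i => A i j) d ⊗ₜ ordProd (x k) F) := by
  induction F using Finset.induction_on_min generalizing d with
  | empty => exact rForm_x_mul_ordProd_of_lt A j ∅ (by simp) d
  | insert l F hF ih =>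
    rcases lt_trichotomy j l with hjl | rfl | hjl
    · refine rForm_x_mul_ordProd_of_lt A j _ (fun i hi => ?_) d
      rcases Finset.mem_insert.1 hi with rfl | hi
      · exact hjl
      · exact hjl.trans (hF i hi)
    · rw [ordProd_insert _ hF, ← mul_assoc, x_mul_x, zero_mul, rForm_x_mul_ordProd_of_lt A j F hF,
        skew_sq]
      simp
    · have hx : x k j * x k l = - (x k l * x k j) := eq_neg_of_add_eq_zero_left (x_x k n j l)
      have hmem : ∀ y ∈ Submodule.span k (ordProd (x k) '' {Q | Q ⊆ insert j F}), ∀ d,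
          rForm A (d ⊗ₜ (x k l * y)) = rForm A (skew (fun i => A i l) d ⊗ₜ y) := by
        intro y hy
        induction hy using Submodule.span_induction with
        | mem y hy =>
          obtain ⟨Q, hQ, rfl⟩ := hy
          refine rForm_x_mul_ordProd_of_lt A l Q fun i hi => ?_
          rcases Finset.mem_insert.1 (hQ hi) with rfl | hi
          · exact hjl
          · exact hF i hi
        | zero => simp
        | add y z _ _ hy hz => intro d; simp only [mul_add, TensorProduct.tmul_add, map_add, hy, hz]
        | smul a y _ hy => intro d; simp only [mul_smul_comm, TensorProduct.tmul_smul, map_smul, hy]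
      have hy := mul_ordProd_mem (k := k) (x k) 0 0 (by simp [x_mul_x]) (by simp [x_x]) j F
      rw [ordProd_insert _ hF, ← mul_assoc, hx, neg_mul, mul_assoc, TensorProduct.tmul_neg, map_neg,
        hmem _ hy, ih, rForm_x_mul_ordProd_of_lt A l F hF, skew_skew, TensorProduct.neg_tmul,
        map_neg, neg_neg]

/-- The `r`-form turns left multiplication by `x_j` in the second argument into a skew derivation of
the first argument. -/
theorem rForm_x_mul_right (A : Matrix (Fin n) (Fin n) k) (j : Fin n) (d h : E k n) :
    rForm A (d ⊗ₜ (x k j * h)) = rForm A (skew (fun i => A i j) d ⊗ₜ h) := by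
  have h01 : ∀ a : Fin 2, a = 0 ∨ a = 1 := by decide
  have key : (TensorProduct.curry (rForm A) d) ∘ₗ LinearMap.mulLeft k (x k j) =
      TensorProduct.curry (rForm A) (skew (fun i => A i j) d) := by
    refine basis_induction _ _ fun b F => ?_
    rcases h01 b with rfl | rfl
    · simpa using rForm_x_mul_ordProd A j F d
    -- The sign from moving x_j past c is absorbed because the skew derivation anticommutes with
    -- `inv`.
    · have hx : x k j * c k n = - (c k n * x k j) := eq_neg_of_add_eq_zero_right (c_x k n j)
      simp only [LinearMap.comp_apply, TensorProduct.curry_apply, LinearMap.mulLeft_apply,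
        Fin.val_one, pow_one]
      rw [← mul_assoc, hx, neg_mul, mul_assoc, TensorProduct.tmul_neg, map_neg, rForm_c_mul_right,
        rForm_x_mul_ordProd, rForm_c_mul_right, inv_skew, TensorProduct.neg_tmul, map_neg]
  exact LinearMap.congr_fun key h

theorem rForm_one_right (A : Matrix (Fin n) (Fin n) k) (d : E k n) :
    rForm A (d ⊗ₜ 1) = counitHom k n d := by
  have h1 : (1 : E k n) = ordProd (x k) ∅ := by simp [ordProd]
  have key : (TensorProduct.curry (rForm A)).flip 1 = (counitHom k n).toLinearMap := by
    refine basis_induction _ _ fun a P => ?_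
    have h := rForm_basis A a 0 P ∅
    simp only [Fin.val_zero, pow_zero, one_mul, zero_mul, mul_one] at h
    simp only [LinearMap.flip_apply, TensorProduct.curry_apply, AlgHom.toLinearMap_apply, map_mul,
      map_pow]
    rw [h1, h]
    rcases P.eq_empty_or_nonempty with rfl | hP
    · rw [minorSum_eq_det A ∅ ∅ rfl rfl]
      simp [counitHom, ordProd]
    · rw [minorSum_eq_zero A (by simpa [eq_comm] using hP.ne_empty)]
      have : ordProd (x k) P = x k (P.min' hP) * ordProd (x k) (P.erase (P.min' hP)) := by
        rw [← ordProd_insert _ fun j hj => Finset.min'_lt_of_mem_erase_min' _ _ hj,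
          Finset.insert_erase (P.min'_mem hP)]
      simp [this, counitHom]
  exact LinearMap.congr_fun key d

/-! ### Reversal -/

/-- The reversal `c ↦ c`, `x_i ↦ x_i` as an algebra map to the opposite algebra. -/
def reverseHom : E k n →ₐ[k] (E k n)ᵐᵒᵖ :=
  lift (MulOpposite.op (c k n)) (fun i => MulOpposite.op (x k i))
    (by simp [← MulOpposite.op_mul, c_mul_c])
    (fun i => by simp [← MulOpposite.op_mul, ← MulOpposite.op_add, add_comm (x k i * _), c_x])
    (fun i j => by simp [← MulOpposite.op_mul, ← MulOpposite.op_add, x_x])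
    (fun i => by simp [← MulOpposite.op_mul, x_mul_x])

/-- The anti-automorphism of `E(n)` fixing the generators. -/
def reverse : E k n →ₗ[k] E k n :=
  (MulOpposite.opLinearEquiv k).symm.toLinearMap ∘ₗ reverseHom.toLinearMap

theorem reverse_mul (a b : E k n) : reverse (a * b) = reverse b * reverse a := by simp [reverse]

@[simp]
theorem reverse_one : reverse (1 : E k n) = 1 := by simp [reverse]

@[simp]
theorem reverse_c : reverse (c k n) = c k n := by simp [reverse, reverseHom]

@[simp]
theorem reverse_x (i : Fin n) : reverse (x k i) = x k i := by simp [reverse, reverseHom]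

/-- x_i anticommutes with every generator, itself included because x_i² = 0. -/
theorem mul_x (i : Fin n) (a : E k n) : a * x k i = x k i * inv a :=
  linearMap_eq_of_adjoin adjoin_gens (LinearMap.mulRight k (x k i))
    (LinearMap.mulLeft k (x k i) ∘ₗ inv.toLinearMap) (by simp)
    (fun j a ha => by
      have ha' : a * x k i = x k i * inv a := ha
      rcases j with j | j
      · have h : c k n * x k i = - (x k i * c k n) := eq_neg_of_add_eq_zero_left (c_x k n i)
        simp [gens, mul_assoc, ha', ← mul_assoc (c k n), h]
      · have h : x k j * x k i = - (x k i * x k j) := eq_neg_of_add_eq_zero_left (x_x k n j i)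
        simp [gens, mul_assoc, ha', ← mul_assoc (x k j), h]) a

theorem ordProd_mul_c (P : Finset (Fin n)) :
    ordProd (x k) P * c k n = (-1 : k) ^ P.card • (c k n * ordProd (x k) P) := by
  induction P using Finset.induction_on_min with
  | empty => simp [ordProd]
  | insert i P hP ih =>
    have h : x k i * c k n = - (c k n * x k i) := eq_neg_of_add_eq_zero_right (c_x k n i)
    rw [ordProd_insert _ hP, mul_assoc, ih,
      Finset.card_insert_of_notMem fun h => lt_irrefl _ (hP i h), mul_smul_comm, ← mul_assoc, h]
    simp [pow_succ, mul_assoc]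

theorem reverse_ordProd (P : Finset (Fin n)) :
    reverse (ordProd (x k) P) = (-1 : k) ^ (P.card * (P.card - 1) / 2) • ordProd (x k) P := by
  induction P using Finset.induction_on_min with
  | empty => simp [ordProd]
  | insert i P hP ih =>
    rw [ordProd_insert _ hP, reverse_mul, ih,
      Finset.card_insert_of_notMem fun h => lt_irrefl _ (hP i h), neg_one_pow_triangle, reverse_x,
      smul_mul_assoc, mul_x, inv_ordProd, mul_smul_comm, smul_smul, mul_comm]

theorem reverse_basis (a : Fin 2) (P : Finset (Fin n)) :
    reverse (c k n ^ (a : ℕ) * ordProd (x k) P) =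
      ((-1 : k) ^ (P.card * (P.card - 1) / 2) * (-1) ^ ((a : ℕ) * P.card)) •
        (c k n ^ (a : ℕ) * ordProd (x k) P) := by
  have h01 : ∀ a : Fin 2, a = 0 ∨ a = 1 := by decide
  rcases h01 a with rfl | rfl
  · simp [reverse_ordProd]
  · simp [reverse_mul, reverse_ordProd, ordProd_mul_c, smul_smul]

/-- Only |P| = |F| matters. Reversal contributes the same triangular sign for both words, so these
cancel; its signs for moving c past x_P and x_F exchange the roles of the two exponents of c.
Swapping P and F transposes the minor. -/
theorem rForm_reverse (A : Matrix (Fin n) (Fin n) k) (h g : E k n) :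
    rForm A (reverse h ⊗ₜ reverse g) = rForm A.transpose (g ⊗ₜ h) := by
  have key : (TensorProduct.curry (rForm A)).compl₁₂ reverse reverse =
      (TensorProduct.curry (rForm A.transpose)).flip := by
    refine basis_induction _ _ fun a P => basis_induction _ _ fun b F => ?_
    simp only [LinearMap.compl₁₂_apply, TensorProduct.curry_apply, LinearMap.flip_apply,
      reverse_basis, rForm_basis, minorSum_transpose, map_smul, LinearMap.smul_apply]
    by_cases hPF : F.card = P.card
    · rw [hPF]
      have hs : ∀ m : ℕ, (-1 : k) ^ m * (-1) ^ m = 1 := fun m => by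
        rw [← mul_pow, neg_one_mul, neg_neg, one_pow]
      have h1 := hs (P.card * (P.card - 1) / 2)
      have h2 := hs ((b : ℕ) * P.card)
      simp only [smul_eq_mul, mul_add, pow_add, mul_comm (a : ℕ) (b : ℕ)]
      linear_combination ((-1) ^ (P.card * (P.card - 1) / 2) * minorSum A P F *
        (-1) ^ ((a : ℕ) * P.card) * (-1) ^ ((b : ℕ) * (a : ℕ))) *
          ((-1) ^ ((b : ℕ) * P.card) * (-1) ^ ((b : ℕ) * P.card) * h1 + h2)
    · simp [minorSum_eq_zero A hPF]
  exact LinearMap.congr_fun (LinearMap.congr_fun key h) g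

end E

/-! ### F and G for an opposite comodule algebra -/

section Op

variable {k : Type*} [Field k] {H : Type*} [Ring H] [HopfAlgebra k H] {B : Type*} [Ring B]
  [Algebra k B]

/-- The pairing `(d ⊗ g, b ⊗ h) ↦ r(g ⊗ h) b d`. -/
def opPairing (B : Type*) [Ring B] [Algebra k B] (r : H ⊗[k] H →ₗ[k] k) :
    B ⊗[k] H →ₗ[k] B ⊗[k] H →ₗ[k] B :=
  (TensorProduct.map₂ (LinearMap.mul k B).flip (TensorProduct.curry r)).compr₂
    (TensorProduct.rid k B).toLinearMap

@[simp]
theorem opPairing_tmul (r : H ⊗[k] H →ₗ[k] k) (d b : B) (g h : H) :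
    opPairing B r (d ⊗ₜ g) (b ⊗ₜ h) = r (g ⊗ₜ h) • (b * d) := by
  simp [opPairing]

variable [Module.Finite k B] (S : RightComoduleAlgebra k H B) (r : H ⊗[k] H →ₗ[k] k)

theorem twistedMul_op (a b : B) :
    S.op.twistedMul r (MulOpposite.op a) (MulOpposite.op b) =
      MulOpposite.op (opPairing B r (S.coact a) (S.coact b)) := by
  have key : ∀ s t : B ⊗[k] H, TensorProduct.rid k Bᵐᵒᵖ
      (TensorProduct.map (LinearMap.mul' k Bᵐᵒᵖ) r
        (TensorProduct.tensorTensorTensorComm k Bᵐᵒᵖ H Bᵐᵒᵖ H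
          ((MulOpposite.opLinearEquiv k (M := B)).toLinearMap.rTensor H s ⊗ₜ
            (MulOpposite.opLinearEquiv k (M := B)).toLinearMap.rTensor H t))) =
      MulOpposite.op (opPairing B r s t) := by
    intro s t
    induction s with
    | zero => simp
    | add x y hx hy =>
      simp only [map_add, TensorProduct.add_tmul, hx, hy, LinearMap.add_apply, MulOpposite.op_add]
    | tmul x y =>
      induction t with
      | zero => simp
      | add x y hx hy => simp only [map_add, TensorProduct.tmul_add, hx, hy, MulOpposite.op_add]
      | tmul z w => simp
  exact key _ _

theorem op_F_apply (a b d : B) :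
    S.op.F r (MulOpposite.op a ⊗ₜ MulOpposite.op b) (MulOpposite.op d) =
      MulOpposite.op (opPairing B r (S.coact d) (S.coact b) * a) := by
  simp [ComodAlg.F, twistedMul_op]

theorem op_G_apply (a b d : B) :
    S.op.G r (MulOpposite.op a ⊗ₜ MulOpposite.op b) (MulOpposite.op d) =
      MulOpposite.op (b * opPairing B r (S.coact a) (S.coact d)) := by
  simp [ComodAlg.G, twistedMul_op]

end Op

/-! ### The Clifford algebra as a twisted action -/

namespace Cl

universe u

variable {k : Type u} [Field k] {n : ℕ} {α : k} {γ : Fin n → k} {Λ : Matrix (Fin n) (Fin n) k}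

variable (α γ Λ) in
/-- The generators of `Cl(α, γ, Λ)` as one family. -/
def gens : Unit ⊕ Fin n → Cl α γ Λ := Sum.elim (fun _ => u α γ Λ) (v α γ Λ)

theorem adjoin_gens : Algebra.adjoin k (Set.range (gens α γ Λ)) = ⊤ := by
  rw [← adjoin_eq_top α γ Λ, gens, Set.Sum.elim_range, Set.range_const, Set.singleton_union]

variable (α γ Λ) in
/-- The matrix of anticommutators of the generators. -/
def gram : Matrix (Unit ⊕ Fin n) (Unit ⊕ Fin n) k :=
  Matrix.fromBlocks (Matrix.of fun _ _ => 2 * α) (Matrix.of fun _ j => γ j)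
    (Matrix.of fun i _ => γ i) (Λ + Λ.transpose)

theorem gens_mul (hΛ : ∀ i j, i < j → Λ i j = 0) (i j : Unit ⊕ Fin n) :
    gens α γ Λ i * gens α γ Λ j + gens α γ Λ j * gens α γ Λ i =
      algebraMap k _ (gram α γ Λ i j) := by
  rcases i with i | i <;> rcases j with j | j
  · simp [gens, gram, u_mul_u, two_mul]
  · simp [gens, gram, u_v]
  · simp [gens, gram, add_comm (v α γ Λ i * _), u_v]
  · rcases lt_trichotomy i j with h | rfl | h
    · simp [gens, gram, add_comm (v α γ Λ i * _), v_v _ _ _ _ _ h, hΛ i j h]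
    · simp [gens, gram, v_mul_v]
    · simp [gens, gram, v_v _ _ _ _ _ h, hΛ j i h]

/-- The grading involution of `Cl(α, γ, Λ)`. -/
def inv : Cl α γ Λ →ₐ[k] Cl α γ Λ :=
  lift (-u α γ Λ) (fun i => -v α γ Λ i) (by simp [u_mul_u]) (by simp [u_v]) (by simp [v_mul_v])
    (fun i j h => by simp [v_v _ _ _ _ _ h])

@[simp]
theorem inv_u : inv (u α γ Λ) = - u α γ Λ := lift_u ..

@[simp]
theorem inv_v (i : Fin n) : inv (v α γ Λ i) = - v α γ Λ i := lift_v ..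

/-- The algebra map `u ↦ diag(u, -u)`, `v_i ↦ (v_i, f i; 0, -v_i)`. -/
def skewMatrix (f : Fin n → k) : Cl α γ Λ →ₐ[k] Matrix (Fin 2) (Fin 2) (Cl α γ Λ) :=
  lift !![u α γ Λ, 0; 0, -u α γ Λ] (fun i => !![v α γ Λ i, algebraMap k _ (f i); 0, -v α γ Λ i])
    (by
      ext a b
      fin_cases a <;> fin_cases b <;> simp [u_mul_u, Matrix.algebraMap_matrix_apply])
    (fun i => by
      ext a b
      fin_cases a <;> fin_cases b <;>
        simp [Matrix.algebraMap_matrix_apply, Algebra.algebraMap_eq_smul_one (f i), u_v])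
    (fun i => by
      ext a b
      fin_cases a <;> fin_cases b <;>
        simp [Matrix.algebraMap_matrix_apply, Algebra.algebraMap_eq_smul_one (f i), v_mul_v])
    (fun i j h => by
      ext a b
      fin_cases a <;> fin_cases b <;>
        simp [Matrix.algebraMap_matrix_apply, Algebra.algebraMap_eq_smul_one (f i),
          Algebra.algebraMap_eq_smul_one (f j), v_v _ _ _ _ _ h])

/-- The skew derivation of `Cl(α, γ, Λ)` with `u ↦ 0` and `v_i ↦ f i`. -/
def skew (f : Fin n → k) : Cl α γ Λ →ₗ[k] Cl α γ Λ := upperRight (skewMatrix f)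

@[simp]
theorem skew_u (f : Fin n → k) : skew f (u α γ Λ) = 0 := by
  simp [skew, upperRight_apply, skewMatrix]

@[simp]
theorem skew_v (f : Fin n → k) (i : Fin n) : skew f (v α γ Λ i) = algebraMap k _ (f i) := by
  simp [skew, upperRight_apply, skewMatrix]

theorem skew_mul (f : Fin n → k) (a b : Cl α γ Λ) :
    skew f (a * b) = a * skew f b + skew f a * inv b := by
  refine skew_mul_of_matrix _ (adjoin_eq_top α γ Λ) inv (skewMatrix f) ?_ a b
  rintro _ (rfl | ⟨i, rfl⟩) <;> simp [skewMatrix]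

@[simp]
theorem skew_one (f : Fin n → k) : skew f (1 : Cl α γ Λ) = 0 := by
  simpa using skew_mul f (1 : Cl α γ Λ) 1

/-! ### Compatibility with the coaction -/

theorem coactHom_inv (d : Cl α γ Λ) :
    coactHom α γ Λ (inv d) = E.inv.toLinearMap.lTensor _ (coactHom α γ Λ d) := by
  have key : (coactHom α γ Λ).comp inv =
      (Algebra.TensorProduct.map (.id k _) E.inv).comp (coactHom α γ Λ) := by
    refine algHom_ext ?_ fun i => ?_
    · simp [coactHom_u, TensorProduct.tmul_neg]
    · simp [coactHom_v, TensorProduct.tmul_neg, add_comm]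
  exact AlgHom.congr_fun key d

/-- Both derivations kill the distinguished letter and send the i-th letter to f i. In ρ(v_i) the
first summand yields f i and an `inv`, which `coactHom_inv` identifies with the involution of the
Clifford algebra. -/
theorem coactHom_skew (f : Fin n → k) (d : Cl α γ Λ) :
    coactHom α γ Λ (skew f d) = (E.skew f).lTensor _ (coactHom α γ Λ d) := by
  refine linearMap_eq_of_adjoin adjoin_gens ((coactHom α γ Λ).toLinearMap ∘ₗ skew f)
    ((E.skew f).lTensor _ ∘ₗ (coactHom α γ Λ).toLinearMap) ?_ ?_ d
  · simp [Algebra.TensorProduct.one_def]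
  · intro i d hd
    have hd' : coactHom α γ Λ (skew f d) = (E.skew f).lTensor _ (coactHom α γ Λ d) := hd
    have hc : ∀ (b : Cl α γ Λ) (t : Cl α γ Λ ⊗[k] E k n), (E.skew f).lTensor _ (b ⊗ₜ E.c k n * t) =
        b ⊗ₜ E.c k n * (E.skew f).lTensor _ t := by
      intro b t
      induction t with
      | zero => simp
      | add x y hx hy => simp only [mul_add, map_add, hx, hy]
      | tmul x y => simp [E.skew_c_mul]
    have hx : ∀ (j : Fin n) (t : Cl α γ Λ ⊗[k] E k n),
        (E.skew f).lTensor _ ((1 : Cl α γ Λ) ⊗ₜ E.x k j * t) =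
          1 ⊗ₜ E.x k j * (E.skew f).lTensor _ t + f j • E.inv.toLinearMap.lTensor _ t := by
      intro j t
      induction t with
      | zero => simp
      | add x y hx hy =>
        simp only [mul_add, map_add, hx, hy, smul_add]
        abel
      | tmul x y => simp [E.skew_x_mul, TensorProduct.tmul_add]
    rcases i with i | i
    · simp [gens, skew_mul, coactHom_u, hd', hc]
    · simp only [gens, Sum.elim_inr, LinearMap.comp_apply, AlgHom.toLinearMap_apply, skew_mul,
        skew_v,
        map_add, map_mul, coactHom_v, add_mul, hd', hc, hx, ← Algebra.smul_def, map_smul,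
        coactHom_inv]
      abel

/-- The operators `Φ_b(d) = ∑ r(d₁ ⊗ b₁) b₀ d₀`. -/
def braidMul (A : Matrix (Fin n) (Fin n) k) : Cl α γ Λ →ₗ[k] Module.End k (Cl α γ Λ) :=
  (opPairing (Cl α γ Λ) (E.rForm A)).flip.compl₁₂ (coactHom α γ Λ).toLinearMap
    (coactHom α γ Λ).toLinearMap

theorem braidMul_apply (A : Matrix (Fin n) (Fin n) k) (b d : Cl α γ Λ) :
    braidMul A b d = opPairing _ (E.rForm A) (coactHom α γ Λ d) (coactHom α γ Λ b) := rfl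

/-- The pairing of the generators with the skew derivations. -/
def extend (A : Matrix (Fin n) (Fin n) k) : Matrix (Unit ⊕ Fin n) (Unit ⊕ Fin n) k :=
  Matrix.fromBlocks 0 0 0 A

/-- The two summands of ρ(v_i) give the two terms of the recursion: 1 ⊗ x_i yields a skew derivation
of d, and v_i ⊗ c yields the involution. For u only the second occurs, so its derivation is zero. -/
theorem twistedAction (hΛ : ∀ i j, i < j → Λ i j = 0) (A : Matrix (Fin n) (Fin n) k) :
    TwistedAction (gens α γ Λ) (gram α γ Λ) (extend A) inv
      (Sum.elim (fun _ => 0) fun j => skew fun i => A i j) (braidMul A) where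
  gen := adjoin_gens
  w_mul := gens_mul hΛ
  σ_w i := by rcases i with i | i <;> simp [gens]
  D_w i j := by rcases i with i | i <;> rcases j with j | j <;> simp [gens, extend]
  D_mul j x y := by rcases j with j | j <;> simp [skew_mul]
  Φ_one := by
    ext d
    have key : ∀ t : Cl α γ Λ ⊗[k] E k n, opPairing _ (E.rForm A) t (1 ⊗ₜ 1) =
        TensorProduct.rid k _ ((Coalgebra.counit (R := k) (A := E k n)).lTensor _ t) := by
      intro t
      induction t with
      | zero => simp
      | add x y hx hy => simp only [map_add, LinearMap.add_apply, hx, hy]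
      | tmul x y => simp [E.rForm_one_right, E.counit_eq]
    rw [braidMul_apply, map_one, Algebra.TensorProduct.one_def, key]
    exact LinearMap.congr_fun (comoduleAlgebra α γ Λ).counit d
  Φ_mul i x d := by
    have hc : ∀ (b : Cl α γ Λ) (t s : Cl α γ Λ ⊗[k] E k n),
        opPairing _ (E.rForm A) t (b ⊗ₜ E.c k n * s) =
          b * opPairing _ (E.rForm A) (E.inv.toLinearMap.lTensor _ t) s := by
      intro b t s
      induction s with
      | zero => simp
      | add x y hx hy => simp only [mul_add, map_add, hx, hy]
      | tmul x y =>
        induction t with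
        | zero => simp
        | add x y hx hy => simp only [mul_add, map_add, LinearMap.add_apply, hx, hy]
        | tmul z w => simp [E.rForm_c_mul_right, mul_assoc]
    have hx : ∀ (j : Fin n) (t s : Cl α γ Λ ⊗[k] E k n),
        opPairing _ (E.rForm A) t ((1 : Cl α γ Λ) ⊗ₜ E.x k j * s) =
          opPairing _ (E.rForm A) ((E.skew fun i => A i j).lTensor _ t) s := by
      intro j t s
      induction s with
      | zero => simp
      | add x y hx hy => simp only [mul_add, map_add, hx, hy]
      | tmul x y =>
        induction t with
        | zero => simp
        | add x y hx hy => simp only [map_add, LinearMap.add_apply, hx, hy]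
        | tmul z w => simp [E.rForm_x_mul_right]
    rcases i with i | i
    · simp [gens, braidMul_apply, coactHom_u, hc, coactHom_inv]
    · simp [gens, braidMul_apply, coactHom_v, add_mul, hc, hx, coactHom_inv, coactHom_skew]

end Cl

/-! ### Independence of the generators, the determinant, and the maps F and G -/

namespace Cl

universe u

variable {k : Type u} [Field k] {n : ℕ} {α : k} {γ : Fin n → k} {Λ : Matrix (Fin n) (Fin n) k}

/-- The algebra `Cl(α, γ, Λ)` maps to a Clifford algebra, hence is nonzero. -/
theorem nontrivial (h2 : (2 : k) ≠ 0) (hΛ : ∀ i j, i < j → Λ i j = 0) :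
    Nontrivial (Cl α γ Λ) := by
  have : Invertible (2 : k) := invertibleOfNonzero h2
  -- A triangular Gram matrix: its diagonal gives the squares and T + Tᵗ the anticommutators, so no
  -- division by 2 enters the quadratic form.
  let T : Matrix (Unit ⊕ Fin n) (Unit ⊕ Fin n) k :=
    Matrix.fromBlocks (Matrix.of fun _ _ => α) 0 (Matrix.of fun i _ => γ i) Λ
  let Q : QuadraticForm k (Unit ⊕ Fin n → k) := (Matrix.toBilin' T).toQuadraticMap
  let e : Unit ⊕ Fin n → CliffordAlgebra Q := fun i => CliffordAlgebra.ι Q (Pi.single i 1)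
  have hsq : ∀ i, e i * e i = algebraMap k _ (T i i) := by
    intro i
    rw [CliffordAlgebra.ι_sq_scalar]
    simp [Q]
  have hadd : ∀ i j, e i * e j + e j * e i = algebraMap k _ (T i j + T j i) := by
    intro i j
    rw [CliffordAlgebra.ι_mul_ι_add_swap]
    simp [Q, LinearMap.BilinMap.polar_toQuadraticMap]
  let φ : Cl α γ Λ →ₐ[k] CliffordAlgebra Q := lift (e (Sum.inl ())) (fun i => e (Sum.inr i))
    (by simp [hsq, T]) (fun i => by simp [hadd, T]) (fun i => by simp [hsq, T])
    (fun i j hij => by simp [hadd, T, hΛ j i hij])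
  exact φ.toRingHom.domain_nontrivial

/-- The unit and the generators are linearly independent. -/
theorem gens_independent (h2 : (2 : k) ≠ 0) (hα : α ≠ 0) (hΛ : ∀ i j, i < j → Λ i j = 0) (s : k)
    (t : Unit ⊕ Fin n → k) (h : ∑ i, t i • gens α γ Λ i = algebraMap k _ s) : t = 0 := by
  have := nontrivial (α := α) (γ := γ) h2 hΛ
  let ev : Finset (Fin n) → Cl α γ Λ ⊗[k] E k n →ₗ[k] Cl α γ Λ := fun P =>
    (TensorProduct.rid k _).toLinearMap ∘ₗ (E.xDual P).lTensor _
  have hd : ∀ (b : Fin 2) (P Q : Finset (Fin n)), E.xDual P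
      (E.c k n ^ (b : ℕ) * ordProd (E.x k) Q) = if b = 0 ∧ Q = P then 1 else 0 := by
    intro b P Q
    rw [E.xDual, ← E.basis_apply, Module.Basis.coord_apply, Module.Basis.repr_self,
      Finsupp.single_apply]
    simp [Prod.ext_iff]
  have h1 : ∀ P : Finset (Fin n), E.xDual P (1 : E k n) = if ∅ = P then 1 else 0 := by
    intro P
    simpa [ordProd] using hd 0 P ∅
  have hc : ∀ P : Finset (Fin n), E.xDual P (E.c k n) = 0 := by
    intro P
    simpa [ordProd] using hd 1 P ∅
  have hx : ∀ (P : Finset (Fin n)) (i : Fin n), E.xDual P (E.x k i) = if {i} = P then 1 else 0 := by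
    intro P i
    simpa [ordProd] using hd 0 P {i}
  have hρ := congrArg (coactHom α γ Λ) h
  rw [AlgHom.commutes] at hρ
  simp only [Fintype.sum_sum_type, Finset.univ_unique, Finset.sum_singleton, gens, Sum.elim_inl,
    Sum.elim_inr, map_add, map_sum, map_smul, coactHom_u, coactHom_v,
    Algebra.TensorProduct.algebraMap_apply] at hρ
  -- After applying ρ, the functional (x_i)^* sees only the term 1 ⊗ x_i.
  have ht : ∀ i, t (Sum.inr i) = 0 := by
    intro i
    have h' := congrArg (ev {i}) hρ
    simp only [ev, LinearMap.comp_apply, map_add, map_sum, map_smul, LinearMap.lTensor_tmul, hc, hx,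
      h1] at h'
    simpa using h'
  have hs : s = 0 := by
    have h' := congrArg (ev ∅) hρ
    simp only [ev, LinearMap.comp_apply, map_add, map_sum, map_smul, LinearMap.lTensor_tmul, hc, hx,
      h1] at h'
    have h'' : algebraMap k (Cl α γ Λ) s = 0 := by simpa [ht] using h'.symm
    exact (map_eq_zero (algebraMap k (Cl α γ Λ))).1 h''
  have hu : t (Sum.inl ()) • u α γ Λ = 0 := by
    simpa [Fintype.sum_sum_type, gens, ht, hs] using h
  -- Multiplying by u replaces u by the nonzero scalar α.
  have hu' : t (Sum.inl ()) * α = 0 := by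
    have h' := congrArg (· * u α γ Λ) hu
    simp only [smul_mul_assoc, u_mul_u, zero_mul] at h'
    rw [Algebra.smul_def, ← map_mul] at h'
    exact (map_eq_zero (algebraMap k (Cl α γ Λ))).1 h'
  funext i
  rcases i with i | i
  · exact (mul_eq_zero.1 hu').resolve_right hα
  · exact ht i

/-- The determinant of the pairing matrix is that of its Schur complement. -/
theorem det_gram_sub_extend_ne_zero_iff (h2 : (2 : k) ≠ 0) (hα : α ≠ 0)
    (A : Matrix (Fin n) (Fin n) k) :
    (gram α γ Λ - (extend A).transpose).det ≠ 0 ↔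
      ((2 * α) • (A - Λ - Λ.transpose) + Matrix.of fun i j => γ i * γ j).det ≠ 0 := by
  have h2α : 2 * α ≠ 0 := mul_ne_zero h2 hα
  let X : Matrix Unit Unit k := Matrix.of fun _ _ => 2 * α
  let Y : Matrix Unit Unit k := Matrix.of fun _ _ => (2 * α)⁻¹
  let R : Matrix Unit (Fin n) k := Matrix.of fun _ j => γ j
  let C : Matrix (Fin n) Unit k := Matrix.of fun i _ => γ i
  let _ : Invertible X := ⟨Y, by ext; simp [X, Y, Matrix.mul_apply, -mul_inv_rev, h2α],
    by ext; simp [X, Y, Matrix.mul_apply, -mul_inv_rev, h2α]⟩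
  have hblock : gram α γ Λ - (extend A).transpose =
      Matrix.fromBlocks X R C (Λ + Λ.transpose - A.transpose) := by
    ext i j
    rcases i with i | i <;> rcases j with j | j <;> simp [gram, extend, X, R, C]
  have hX : X.det = 2 * α := by simp [X]
  -- The transposed matrix is -2α times the Schur complement of the corner 2α, so the determinants
  -- agree up to a nonzero factor.
  have hN : ((2 * α) • (A - Λ - Λ.transpose) + Matrix.of fun i j => γ i * γ j).transpose =
      (-(2 * α)) • (Λ + Λ.transpose - A.transpose -
        C * ⅟X * R) := by
    have hY : ⅟X = Y := rfl
    ext i j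
    simp only [hY, Y, R, C, Matrix.transpose_apply, Matrix.add_apply, Matrix.smul_apply,
      Matrix.sub_apply, Matrix.of_apply, Matrix.mul_apply, smul_eq_mul, Finset.univ_unique,
      Finset.sum_singleton]
    field_simp
    ring
  rw [hblock, Matrix.det_fromBlocks₁₁, hX,
    ← Matrix.det_transpose ((2 * α) • (A - Λ - Λ.transpose) + _), hN, Matrix.det_smul]
  simp [h2, hα]

/-! ### The map `F` -/

variable (α γ Λ) in
/-- The map `x ⊗ y ↦ (d ↦ Φ_y(d) x)`. -/
def braidEnd (A : Matrix (Fin n) (Fin n) k) :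
    Cl α γ Λ ⊗[k] Cl α γ Λ →ₗ[k] Module.End k (Cl α γ Λ) :=
  LinearMap.mul' k (Module.End k (Cl α γ Λ)) ∘ₗ
    TensorProduct.map (LinearMap.mul k (Cl α γ Λ)).flip (braidMul A)

theorem braidEnd_tmul (A : Matrix (Fin n) (Fin n) k) (x y : Cl α γ Λ) :
    braidEnd α γ Λ A (x ⊗ₜ y) = LinearMap.mulRight k x * braidMul A y := rfl

theorem range_braidEnd (A : Matrix (Fin n) (Fin n) k) :
    LinearMap.range (braidEnd α γ Λ A) = Submodule.span k
      (Set.range fun p : Cl α γ Λ × Cl α γ Λ => LinearMap.mulRight k p.1 * braidMul A p.2) := by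
  rw [LinearMap.range_eq_map, ← TensorProduct.span_tmul_eq_top, Submodule.map_span]
  congr 1
  ext T
  constructor
  · rintro ⟨_, ⟨x, y, rfl⟩, rfl⟩
    exact ⟨(x, y), rfl⟩
  · rintro ⟨⟨x, y⟩, rfl⟩
    exact ⟨_, ⟨x, y, rfl⟩, rfl⟩

theorem bijective_braidEnd_iff (h2 : (2 : k) ≠ 0) (hα : α ≠ 0) (hΛ : ∀ i j, i < j → Λ i j = 0)
    (A : Matrix (Fin n) (Fin n) k) : Function.Bijective (braidEnd α γ Λ A) ↔
      ((2 * α) • (A - Λ - Λ.transpose) + Matrix.of fun i j => γ i * γ j).det ≠ 0 := by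
  have hfr : Module.finrank k (Cl α γ Λ ⊗[k] Cl α γ Λ) =
      Module.finrank k (Module.End k (Cl α γ Λ)) := by
    rw [Module.finrank_tensorProduct, Module.finrank_linearMap]
  have hbij : Function.Bijective (braidEnd α γ Λ A) ↔ Function.Surjective (braidEnd α γ Λ A) :=
    ⟨fun h => h.2,
      fun h => ⟨(LinearMap.injective_iff_surjective_of_finrank_eq_finrank hfr).2 h, h⟩⟩
  rw [hbij, ← LinearMap.range_eq_top, range_braidEnd, ← det_gram_sub_extend_ne_zero_iff h2 hα]
  exact ⟨(twistedAction hΛ A).det_ne_zero_of_span_eq_top (gens_independent h2 hα hΛ),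
    (twistedAction hΛ A).span_eq_top h2⟩

/-- Transport along `op`: F(op x ⊗ op y) acts on op d as op(Φ_y(d) x). -/
theorem bijective_F_iff (A : Matrix (Fin n) (Fin n) k) :
    Function.Bijective ((comoduleAlgebra α γ Λ).op.F (E.rForm A)) ↔
      Function.Bijective (braidEnd α γ Λ A) := by
  let o := MulOpposite.opLinearEquiv k (M := Cl α γ Λ)
  have key : (comoduleAlgebra α γ Λ).op.F (E.rForm A) ∘ₗ (TensorProduct.congr o o).toLinearMap =
      o.conj.toLinearMap ∘ₗ braidEnd α γ Λ A := by
    refine TensorProduct.ext' fun x y => LinearMap.ext fun d => ?_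
    exact op_F_apply (comoduleAlgebra α γ Λ) (E.rForm A) x y d.unop
  have key' : ⇑((comoduleAlgebra α γ Λ).op.F (E.rForm A)) ∘ ⇑(TensorProduct.congr o o) =
      ⇑o.conj ∘ ⇑(braidEnd α γ Λ A) := congrArg DFunLike.coe key
  rw [← Function.Bijective.of_comp_iff _ (TensorProduct.congr o o).bijective, key',
    Function.Bijective.of_comp_iff' o.conj.bijective]

/-! ### Reversal and the map `G` -/

/-- The reversal `u ↦ u`, `v_i ↦ v_i` as an algebra map to the opposite algebra. -/
def reverseHom : Cl α γ Λ →ₐ[k] (Cl α γ Λ)ᵐᵒᵖ :=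
  lift (MulOpposite.op (u α γ Λ)) (fun i => MulOpposite.op (v α γ Λ i))
    (by simp [← MulOpposite.op_mul, u_mul_u, MulOpposite.algebraMap_apply])
    (fun i => by simp [← MulOpposite.op_mul, ← MulOpposite.op_add, add_comm (v α γ Λ i * _), u_v,
      MulOpposite.algebraMap_apply])
    (fun i => by simp [← MulOpposite.op_mul, v_mul_v, MulOpposite.algebraMap_apply])
    (fun i j h => by simp [← MulOpposite.op_mul, ← MulOpposite.op_add, add_comm (v α γ Λ j * _),
      v_v _ _ _ _ _ h, MulOpposite.algebraMap_apply])

/-- The anti-automorphism of `Cl(α, γ, Λ)` fixing the generators. -/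
def reverse : Cl α γ Λ →ₗ[k] Cl α γ Λ :=
  (MulOpposite.opLinearEquiv k).symm.toLinearMap ∘ₗ reverseHom.toLinearMap

theorem reverse_mul (a b : Cl α γ Λ) : reverse (a * b) = reverse b * reverse a := by
  simp [reverse]

@[simp]
theorem reverse_one : reverse (1 : Cl α γ Λ) = 1 := by simp [reverse]

@[simp]
theorem reverse_u : reverse (u α γ Λ) = u α γ Λ :=
  congrArg MulOpposite.unop (lift_u ..)

@[simp]
theorem reverse_v (i : Fin n) : reverse (v α γ Λ i) = v α γ Λ i :=
  congrArg MulOpposite.unop (lift_v ..)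

theorem reverse_reverse (a : Cl α γ Λ) : reverse (reverse a) = a :=
  linearMap_eq_of_adjoin adjoin_gens (reverse ∘ₗ reverse) LinearMap.id (by simp)
    (fun i a ha => by
      have ha' : reverse (reverse a) = a := ha
      rcases i with i | i <;> simp [gens, reverse_mul, ha']) a

theorem coactHom_reverse (d : Cl α γ Λ) :
    coactHom α γ Λ (reverse d) = TensorProduct.map reverse E.reverse (coactHom α γ Λ d) := by
  have hmul : ∀ s t : Cl α γ Λ ⊗[k] E k n, TensorProduct.map reverse E.reverse (s * t) =
      TensorProduct.map reverse E.reverse t * TensorProduct.map reverse E.reverse s := by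
    intro s t
    induction s with
    | zero => simp
    | add x y hx hy => simp only [add_mul, mul_add, map_add, hx, hy]
    | tmul x y =>
      induction t with
      | zero => simp
      | add x y hx hy => simp only [add_mul, mul_add, map_add, hx, hy]
      | tmul z w => simp [reverse_mul, E.reverse_mul]
  refine linearMap_eq_of_adjoin adjoin_gens ((coactHom α γ Λ).toLinearMap ∘ₗ reverse)
    (TensorProduct.map reverse E.reverse ∘ₗ (coactHom α γ Λ).toLinearMap)
    (by simp [Algebra.TensorProduct.one_def]) (fun i d hd => ?_) d
  have hd' : coactHom α γ Λ (reverse d) = TensorProduct.map reverse E.reverse (coactHom α γ Λ d) :=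
    hd
  rcases i with i | i <;> simp [gens, reverse_mul, hmul, hd', coactHom_u, coactHom_v]

theorem opPairing_reverse (A : Matrix (Fin n) (Fin n) k) (s t : Cl α γ Λ ⊗[k] E k n) :
    opPairing _ (E.rForm A) (TensorProduct.map reverse E.reverse s)
      (TensorProduct.map reverse E.reverse t) =
      reverse (opPairing _ (E.rForm A.transpose) t s) := by
  induction s with
  | zero => simp
  | add x y hx hy => simp only [map_add, LinearMap.add_apply, hx, hy]
  | tmul x y =>
    induction t with
    | zero => simp
    | add x y hx hy => simp only [map_add, LinearMap.add_apply, hx, hy]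
    | tmul z w => simp [E.rForm_reverse, reverse_mul]

variable (α γ Λ) in
/-- Reversal as a linear equivalence with the opposite algebra. -/
def reverseOp : Cl α γ Λ ≃ₗ[k] (Cl α γ Λ)ᵐᵒᵖ :=
  (LinearEquiv.ofInvolutive reverse reverse_reverse).trans (MulOpposite.opLinearEquiv k)

theorem reverseOp_apply (a : Cl α γ Λ) : reverseOp α γ Λ a = MulOpposite.op (reverse a) := rfl

/-- Conjugating by reversal turns d ↦ b · ∑ r_A(a₁ ⊗ d₁) d₀ a₀ into an operator of the form R_x Φ_y
for Aᵀ. The tensor factors must be swapped, since in G the first factor is braided with d, whereas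
in F the second is. -/
theorem bijective_G_iff (A : Matrix (Fin n) (Fin n) k) :
    Function.Bijective ((comoduleAlgebra α γ Λ).op.G (E.rForm A)) ↔
      Function.Bijective (braidEnd α γ Λ A.transpose) := by
  let o := reverseOp α γ Λ
  let e := (TensorProduct.comm k (Cl α γ Λ) (Cl α γ Λ)).trans (TensorProduct.congr o o)
  have key : (comoduleAlgebra α γ Λ).op.G (E.rForm A) ∘ₗ e.toLinearMap =
      o.conj.toLinearMap ∘ₗ braidEnd α γ Λ A.transpose := by
    refine TensorProduct.ext' fun x y => LinearMap.ext fun d => ?_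
    obtain ⟨d, rfl⟩ := o.surjective d
    have hcoact : (comoduleAlgebra α γ Λ).coact = coactHom α γ Λ := rfl
    have hsymm : o.symm (MulOpposite.op (reverse d)) = d := o.symm_apply_apply d
    simp [e, o, hsymm, reverseOp_apply, op_G_apply, LinearEquiv.conj_apply, braidEnd_tmul,
      reverse_mul,
      braidMul_apply, hcoact, coactHom_reverse, opPairing_reverse]
  have key' : ⇑((comoduleAlgebra α γ Λ).op.G (E.rForm A)) ∘ ⇑e =
      ⇑o.conj ∘ ⇑(braidEnd α γ Λ A.transpose) := congrArg DFunLike.coe key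
  rw [← Function.Bijective.of_comp_iff _ e.bijective, key',
    Function.Bijective.of_comp_iff' o.conj.bijective]

end Cl

end HopfE

end

theorem proposition3p1 {k : Type*} [Field k] (hk : ringChar k ≠ 2) (n : ℕ) (hn : 1 ≤ n)
    (A : Matrix (Fin n) (Fin n) k) (α : k) (hα : α ≠ 0) (γ : Fin n → k)
    (Λ : Matrix (Fin n) (Fin n) k) (hΛ : ∀ i j, i < j → Λ i j = 0) :
    (HopfE.Cl.comoduleAlgebra α γ Λ).op.IsAzumaya (HopfE.E.rForm A) ↔
      ((2 * α) • (A - Λ - Λ.transpose) + Matrix.of fun i j => γ i * γ j).det ≠ 0 := by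
  have h2 : (2 : k) ≠ 0 := Ring.two_ne_zero hk
  -- Replacing A by its transpose transposes the whole matrix, the other terms being symmetric.
  have ht : ((2 * α) • (A.transpose - Λ - Λ.transpose) + Matrix.of fun i j => γ i * γ j).det =
      ((2 * α) • (A - Λ - Λ.transpose) + Matrix.of fun i j => γ i * γ j).det := by
    rw [← Matrix.det_transpose]
    congr 1
    ext i j
    simp only [Matrix.transpose_apply, Matrix.add_apply, Matrix.smul_apply, Matrix.sub_apply,
      Matrix.of_apply, smul_eq_mul]
    ring
  rw [HopfE.ComodAlg.IsAzumaya, HopfE.Cl.bijective_F_iff, HopfE.Cl.bijective_G_iff,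
    HopfE.Cl.bijective_braidEnd_iff h2 hα hΛ, HopfE.Cl.bijective_braidEnd_iff h2 hα hΛ, ht,
    and_self]
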